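/- Conventions. $\mathcal D$ is the category of bounded distributive lattices (with bound-preserving lattice homomorphisms) and $\mathbf 2$ its two-element member. A class $\mathcal A$ of algebras of a common type (with all homomorphisms) is $\mathcal D$-based if certain terms $\wedge,\vee,0,1$ of the type make every $\mathbf A\in\mathcal A$ a bounded distributive lattice $U(\mathbf A)$; $U\colon\mathcal A\to\mathcal D$ is the forgetful functor. $\mathcal A$ is a finitely generated quasivariety if $\mathcal A=\mathbb{ISP}(\mathcal M)$ (isomorphic copies of subalgebras of products, the empty product included) for a finite set $\mathcal M$ of finite algebras. $HU(\mathbf A)=\mathcal D(U(\mathbf A),\mathbf 2)$ is the Priestley dual space, with pointwise order and with the topology of $\mathbf 2^A$. For a family $\mathcal K=(\mathbf B_j)_{j\in J}$ in $\mathcal A$, let $\chi_{\mathcal K}\colon\coprod_{\mathcal D}U(\mathbf B_j)\to U(\coprod_{\mathcal A}\mathbf B_j)$ be the canonical map between the coproducts. Condition (E): $\chi_{\mathcal K}$ is injective for every $\mathcal K$. Condition (S): $\chi_{\mathcal K}$ is surjective for every nonempty $\mathcal K$. $U$ preserves coproducts if it sends every coproduct cocone of $\mathcal A$ (including that of the empty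 family) to a coproduct cocone of $\mathcal D$. $\mathcal A$ admits free products if, for every family of non-trivial algebras of $\mathcal A$, the canonical maps into the coproduct are embeddings. An alter ego of a finite family $\mathcal M$ of finite algebras of $\mathcal A$ consists of a set $R$ of subalgebras of products $\mathbf M_1\times\mathbf M_2$ and a set $G$ of homomorphisms $\mathbf M_1\to\mathbf M_2$ (where $\mathbf M_1,\mathbf M_2\in\mathcal M$). For $\mathbf A\in\mathcal A$ let $D(\mathbf A)$ be the $\mathcal M$-sorted space with sorts $\mathcal A(\mathbf A,\mathbf M)\subseteq M^A$ ($M$ discrete), with $R$ and $G$ lifted pointwise, and let $ED(\mathbf A)$ be the algebra of continuous sort-preserving maps $D(\mathbf A)\to\dot\bigcup\mathcal M$ that preserve $R$ and $G$. The alter ego is a natural duality for $\mathcal A$ if $\mathcal A=\mathbb{ISP}(\mathcal M)$ and each evaluation map $\mathbf A\to ED(\mathbf A)$ is an isomorphism; it is single-sorted if $|\mathcal M|=1$. Given sets $\Omega_{\mathbf M}\subseteq HU(\mathbf M)$ of carrier maps ($\mathbf M\in\mathcal M$), let $R_{\omega_1,\omega_2}$, for $\omega_i\in\Omega_{\mathbf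 M_i}$, be the set of those subalgebras of $\mathbf M_1\times\mathbf M_2$ that are maximal among those contained in $\{(a,b):\omega_1(a)\le\omega_2(b)\}$. A piggyback duality for $\mathcal A$ is a choice of $(\mathcal M,(\Omega_{\mathbf M}))$ such that (Sep) for all $\mathbf M\in\mathcal M$ and $a\neq b$ in $\mathbf M$ there are $\mathbf M'\in\mathcal M$, $u\in\mathcal A(\mathbf M,\mathbf M')$ and $\omega\in\Omega_{\mathbf M'}$ with $\omega(u(a))\ne\omega(u(b))$, and such that the alter ego with $R=\bigcup R_{\omega_1,\omega_2}$ and $G$ = all homomorphisms between members of $\mathcal M$ is a natural duality for $\mathcal A$. It is simple if $\mathcal M=\{\mathbf M\}$ and $\Omega_{\mathbf M}=\{\omega\}$. A simple piggyback duality $(\mathbf M,\omega)$ is $\mathcal D$-$\mathcal P$-based if $R_{\omega,\omega}$ has exactly one element $r$ and, for each $\mathbf A\in\mathcal A$, the map $\Phi_{\mathbf A}\colon D(\mathbf A)=\mathcal A(\mathbf A,\mathbf M)\to HU(\mathbf A)$, $x\mapsto\omega\circ x$, is a topological quotient map for which the lifting of $r$ to $D(\mathbf A)$ is the pullback of the order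 (so that the lifting is a pre-order $\preceq$ and $\Phi_{\mathbf A}$ induces an isomorphism of ordered spaces from $D(\mathbf A)/(\preceq\cap\succeq)$ to $HU(\mathbf A)$), and the Priestley spaces $HU(\mathbf A)$, equipped with the relation $\{(\omega\circ u\circ x)_{u\in\mathcal A(\mathbf M,\mathbf M)} : x\in D(\mathbf A)\}$, represent $\mathcal A$: the continuous, order-preserving, relation-preserving maps $HU(\mathbf B)\to HU(\mathbf A)$ are exactly the maps $y\mapsto y\circ f$ for $f\in\mathcal A(\mathbf A,\mathbf B)$, each for a unique $f$. Theorem. Let $\mathcal A$ be a finitely generated $\mathcal D$-based quasivariety. (i) $\mathcal A$ admits free products if and only if it admits a single-sorted natural duality. (ii) $U$ satisfies (E) if and only if $\mathcal A$ admits a simple piggyback duality. (iii) $U$ satisfies (S) if and only if $\mathcal A$ admits a (single-sorted or multisorted) piggyback duality such that $|R_{\omega_1,\omega_2}|\le1$ for each pair of carrier maps $\omega_1,\omega_2$. Moreover, if some piggyback duality for $\mathcal A$ has this feature, then all piggyback dualities for $\mathcal A$ do. (iv) $U$ preserves coproducts if and only if $\mathcal A$ admits a simple piggyback duality that is also $\mathcal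 D$-$\mathcal P$-based. If moreover $\mathcal A$ is a variety (closed under homomorphic images), then $U$ preserves coproducts if and only if $\mathcal A$ admits a simple piggyback duality that is $\mathcal D$-$\mathcal P$-based and for which every map $\Phi_{\mathbf A}$ is injective, so that $D(\mathbf A)$ itself, with its topology and ordered by the lifting of $r$, is isomorphic to $HU(\mathbf A)$. -/

import Mathlib

open CategoryTheory CategoryTheory.Limits FirstOrder FirstOrder.Language

universe v w u

/-! ### Algebras in an algebraic language -/

/-- An algebra of type `L` (for an algebraic language, i.e. one without relation symbols). -/
structure Alg (L : FirstOrder.Language.{v, w}) where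
  carrier : Type u
  [str : L.Structure carrier]

namespace Alg

variable {L : FirstOrder.Language.{v, w}}

instance : CoeSort (Alg.{v, w, u} L) (Type u) := ⟨Alg.carrier⟩

instance (A : Alg.{v, w, u} L) : L.Structure A := A.str

/-- Morphisms of algebras are the homomorphisms. -/
instance : Category.{u} (Alg.{v, w, u} L) where
  Hom A B := A →[L] B
  id A := FirstOrder.Language.Hom.id L A
  comp f g := g.comp f

/-- The direct product of two algebras. -/
def prod (A B : Alg.{v, w, u} L) : Alg.{v, w, u} L where
  carrier := A × B
  str :=
    { funMap := fun f x =>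
        (Structure.funMap f fun i => (x i).1, Structure.funMap f fun i => (x i).2)
      RelMap := fun r x =>
        (Structure.RelMap r fun i => (x i).1) ∧ (Structure.RelMap r fun i => (x i).2) }

/-- The direct product of a family of algebras. -/
def pi {I : Type u} (B : I → Alg.{v, w, u} L) : Alg.{v, w, u} L where
  carrier := ∀ i, B i
  str :=
    { funMap := fun f x i => Structure.funMap f fun k => x k i
      RelMap := fun r x => ∀ i, Structure.RelMap r fun k => x k i }

/-- `ISP(M)`: isomorphic copies of subalgebras of (possibly empty) products of members of the
family `M`. -/
def ISP {S : Type} (M : S → Alg.{v, w, u} L) : ObjectProperty (Alg.{v, w, u} L) :=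
  fun A => ∃ (I : Type u) (k : I → S), Nonempty (A ↪[L] pi fun i => M (k i))

end Alg

/-! ### Classes of algebras with a bounded distributive lattice reduct -/

/-- Terms of `L` intended to denote the operations of a bounded distributive lattice. -/
structure LatticeTerms (L : FirstOrder.Language.{v, w}) where
  meet : L.Term (Fin 2)
  join : L.Term (Fin 2)
  bot : L.Term (Fin 0)
  top : L.Term (Fin 0)

namespace LatticeTerms

variable {L : FirstOrder.Language.{v, w}} (σ : LatticeTerms L) (A : Type u) [L.Structure A]

def inf (a b : A) : A := σ.meet.realize ![a, b]
def sup (a b : A) : A := σ.join.realize ![a, b]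
def zero : A := σ.bot.realize ![]
def one : A := σ.top.realize ![]

/-- `(A, ∧, ∨, 0, 1)` is a bounded distributive lattice. -/
structure IsBDL : Prop where
  inf_comm : ∀ a b : A, σ.inf A a b = σ.inf A b a
  inf_assoc : ∀ a b c : A, σ.inf A (σ.inf A a b) c = σ.inf A a (σ.inf A b c)
  sup_comm : ∀ a b : A, σ.sup A a b = σ.sup A b a
  sup_assoc : ∀ a b c : A, σ.sup A (σ.sup A a b) c = σ.sup A a (σ.sup A b c)
  sup_inf_self : ∀ a b : A, σ.sup A a (σ.inf A a b) = a
  inf_sup_self : ∀ a b : A, σ.inf A a (σ.sup A a b) = a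
  inf_sup_left : ∀ a b c : A,
    σ.inf A a (σ.sup A b c) = σ.sup A (σ.inf A a b) (σ.inf A a c)
  zero_sup : ∀ a : A, σ.sup A (σ.zero A) a = a
  sup_one : ∀ a : A, σ.sup A a (σ.one A) = σ.one A

variable {σ A}

/-- The bounded distributive lattice `(A, ∧, ∨, 0, 1)`; its order is `a ≤ b ↔ a ∨ b = b`. -/
@[reducible] def IsBDL.toLattice (h : σ.IsBDL A) : Lattice A :=
  @Lattice.mk' A ⟨σ.sup A⟩ ⟨σ.inf A⟩ h.sup_comm h.sup_assoc h.inf_comm h.inf_assoc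
    h.sup_inf_self h.inf_sup_self

@[reducible] def IsBDL.toDistribLattice (h : σ.IsBDL A) : DistribLattice A :=
  letI := h.toLattice
  DistribLattice.ofInfSupLe fun a b c => (h.inf_sup_left a b c).le

@[reducible] def IsBDL.toBoundedOrder (h : σ.IsBDL A) :
    @BoundedOrder A h.toDistribLattice.toLE :=
  letI := h.toDistribLattice
  { top := σ.one A
    le_top := fun a => sup_eq_right.1 (h.sup_one a)
    bot := σ.zero A
    bot_le := fun a => sup_eq_right.1 (h.zero_sup a) }

def IsBDL.toBddDistLat (h : σ.IsBDL A) : BddDistLat.{u} :=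
  letI := h.toDistribLattice
  letI := h.toBoundedOrder
  BddDistLat.of A

theorem realize_two {B : Type u} [L.Structure B] (f : A →[L] B) (t : L.Term (Fin 2)) (a b : A) :
    f (t.realize ![a, b]) = t.realize ![f a, f b] := by
  rw [← HomClass.realize_term]
  congr 1
  funext i
  fin_cases i <;> rfl

theorem realize_zero {B : Type u} [L.Structure B] (f : A →[L] B) (t : L.Term (Fin 0)) :
    f (t.realize ![]) = t.realize ![] := by
  rw [← HomClass.realize_term]
  congr 1
  funext i
  exact i.elim0

/-- A homomorphism of algebras, viewed as a homomorphism of the lattice reducts. -/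
def IsBDL.map {B : Type u} [L.Structure B] (hA : σ.IsBDL A) (hB : σ.IsBDL B) (f : A →[L] B) :
    hA.toBddDistLat ⟶ hB.toBddDistLat :=
  letI := hA.toDistribLattice
  letI := hA.toBoundedOrder
  letI := hB.toDistribLattice
  letI := hB.toBoundedOrder
  BddDistLat.ofHom
    { toFun := f
      map_sup' := fun a b => realize_two f σ.join a b
      map_inf' := fun a b => realize_two f σ.meet a b
      map_top' := realize_zero f σ.top
      map_bot' := realize_zero f σ.bot }

end LatticeTerms

/-- A class of algebras with a bounded distributive lattice reduct: a class of algebras of type `L`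
together with terms of `L` which on each algebra of the class define a bounded distributive
lattice. -/
structure DBasedClass (L : FirstOrder.Language.{v, w}) where
  mem : ObjectProperty (Alg.{v, w, u} L)
  terms : LatticeTerms L
  isBDL : ∀ A : Alg.{v, w, u} L, mem A → terms.IsBDL A

namespace DBasedClass

variable {L : FirstOrder.Language.{v, w}} (𝒜 : DBasedClass.{v, w, u} L)

/-- The algebras of the class (a category, with all homomorphisms as morphisms). -/
abbrev Obj := 𝒜.mem.FullSubcategory

/-- The set `𝒜(A, B)` of homomorphisms. -/
abbrev Hom {𝒜 : DBasedClass.{v, w, u} L} (A B : 𝒜.Obj) := A.obj →[L] B.obj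

/-- The homomorphism underlying a morphism of the category. -/
def toHom {𝒜 : DBasedClass.{v, w, u} L} {A B : 𝒜.Obj} (f : A ⟶ B) : Hom A B := f.hom

/-- The forgetful functor to bounded distributive lattices. -/
def U : 𝒜.Obj ⥤ BddDistLat.{u} where
  obj A := (𝒜.isBDL A.obj A.property).toBddDistLat
  map {A B} f := (𝒜.isBDL A.obj A.property).map (𝒜.isBDL B.obj B.property) f.hom

/-- The class is a finitely generated quasivariety: it is `ISP` of a finite set of finite
algebras. -/
def FinitelyGenerated : Prop :=
  ∃ (S : Type) (_ : Finite S) (M : S → Alg.{v, w, u} L),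
    (∀ s, Finite (M s)) ∧ 𝒜.mem = Alg.ISP M

/-- The class is closed under homomorphic images. -/
def ClosedUnderImages : Prop :=
  ∀ (A B : Alg.{v, w, u} L) (f : A →[L] B), Function.Surjective f → 𝒜.mem A → 𝒜.mem B

/-! ### Coproducts -/

/-- The forgetful functor preserves coproducts (of all families, the empty one included). -/
def PreservesCoproducts : Prop :=
  ∀ J : Type u, PreservesColimitsOfShape (Discrete J) 𝒜.U

/-- The map `χ : ∐ U(K j) ⟶ U(∐ K j)` determined by `ε j ≫ χ = U (ϵ j)`, for a coproduct `(c, ϵ)` of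
the algebras `K j` in the class and a coproduct `(d, ε)` of their lattice reducts. -/
def χ {𝒜 : DBasedClass.{v, w, u} L} {J : Type u} {K : J → 𝒜.Obj} (c : Cofan K)
    {d : Cofan fun j => 𝒜.U.obj (K j)} (hd : IsColimit d) : d.pt ⟶ 𝒜.U.obj c.pt :=
  Cofan.IsColimit.desc hd fun j => 𝒜.U.map (c.inj j)

/-- Condition (E): the maps `χ` are injective, for all families of algebras. (Coproducts exist in
both categories and are unique up to isomorphism.) -/
def CondE : Prop :=
  ∀ (J : Type u) (K : J → 𝒜.Obj) (c : Cofan K) (_ : IsColimit c)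
    (d : Cofan fun j => 𝒜.U.obj (K j)) (hd : IsColimit d), Function.Injective (χ c hd)

/-- Condition (S): the maps `χ` are surjective, for all nonempty families of algebras. -/
def CondS : Prop :=
  ∀ (J : Type u) [Nonempty J] (K : J → 𝒜.Obj) (c : Cofan K) (_ : IsColimit c)
    (d : Cofan fun j => 𝒜.U.obj (K j)) (hd : IsColimit d), Function.Surjective (χ c hd)

/-- The class admits free products: every family of non-trivial algebras has a coproduct whose
canonical maps are embeddings. -/
def AdmitsFreeProducts : Prop :=
  ∀ (J : Type u) (K : J → 𝒜.Obj), (∀ j, Nontrivial (K j).obj) →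
    ∃ c : Cofan K, Nonempty (IsColimit c) ∧
      ∀ j, Function.Injective (toHom (c.inj j))

noncomputable section

/-! ### Priestley dual spaces and hom-spaces -/

variable {𝒜}

/-- The Priestley dual space of the lattice reduct of `A`: the set of bounded lattice
homomorphisms to the two-element lattice. -/
def HU (A : 𝒜.Obj) : Type u := BoundedLatticeHom (𝒜.U.obj A) Bool

namespace HU

/-- Evaluation of a lattice homomorphism at an element of the algebra. -/
def ev {A : 𝒜.Obj} (y : HU A) (a : A.obj) : Bool := DFunLike.coe (F := BoundedLatticeHom _ _) y a

theorem ev_injective (A : 𝒜.Obj) : Function.Injective (ev : HU A → A.obj → Bool) :=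
  DFunLike.coe_injective (F := BoundedLatticeHom (𝒜.U.obj A) Bool)

/-- The order is pointwise. -/
instance (A : 𝒜.Obj) : PartialOrder (HU A) := PartialOrder.lift ev (ev_injective A)

/-- The topology is induced from the power `2 ^ A`, with `2` discrete. -/
instance (A : 𝒜.Obj) : TopologicalSpace (HU A) := TopologicalSpace.induced ev inferInstance

/-- The composite `ω ∘ x`. -/
def comp {A M : 𝒜.Obj} (ω : HU M) (x : Hom A M) : HU A :=
  BoundedLatticeHom.comp (α := 𝒜.U.obj A) (β := 𝒜.U.obj M) ω (𝒜.U.map ⟨x⟩).hom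

end HU

/-- The topology on `𝒜(A, M)` induced from the power `M ^ A`, where `M` is discrete. -/
@[reducible] def homTopology (A M : 𝒜.Obj) : TopologicalSpace (Hom A M) :=
  TopologicalSpace.induced (fun x a => x a) (@Pi.topologicalSpace A.obj (fun _ => M.obj) fun _ => ⊥)

/-- The pointwise lifting of an algebraic relation to the hom-sets out of `A`. -/
def lift {A M N : 𝒜.Obj} (r : L.Substructure (Alg.prod M.obj N.obj)) (x : Hom A M)
    (y : Hom A N) : Prop :=
  ∀ a : A.obj, ((x a, y a) : M.obj × N.obj) ∈ r

/-! ### Natural dualities -/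

variable (𝒜)

/-- A (multisorted) alter ego of a finite family of finite algebras of the class, with discrete
topology: a set of binary algebraic relations and a set of homomorphisms between its sorts. -/
structure AlterEgo where
  S : Type
  finS : Finite S
  M : S → 𝒜.Obj
  finM : ∀ s, Finite (M s).obj
  R : ∀ s t, Set (L.Substructure (Alg.prod (M s).obj (M t).obj))
  G : ∀ s t, Set (Hom (M s) (M t))

namespace AlterEgo

variable {𝒜} (T : 𝒜.AlterEgo) (A : 𝒜.Obj)

/-- The underlying set of the dual space `D(A)`: the disjoint union of the sorts `𝒜(A, M s)`. -/
abbrev D := Σ s, Hom A (T.M s)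

/-- A sort-preserving map from `D(A)` to the alter ego is a morphism if it is continuous and
preserves the relations and the operations. -/
structure IsMorphism (φ : ∀ p : T.D A, (T.M p.1).obj) : Prop where
  continuous : ∀ s, @Continuous (Hom A (T.M s)) (T.M s).obj (homTopology A (T.M s)) ⊥
    fun x => φ ⟨s, x⟩
  rel : ∀ s t, ∀ r ∈ T.R s t, ∀ (x : Hom A (T.M s)) (y : Hom A (T.M t)), lift r x y →
    ((φ ⟨s, x⟩, φ ⟨t, y⟩) : (T.M s).obj × (T.M t).obj) ∈ r
  op : ∀ s t, ∀ g ∈ T.G s t, ∀ x : Hom A (T.M s), φ ⟨t, g.comp x⟩ = g (φ ⟨s, x⟩)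

/-- The algebra `ED(A)` of all morphisms from `D(A)` to the alter ego, with pointwise operations. -/
def ED : L.Substructure (Alg.pi fun p : T.D A => (T.M p.1).obj) where
  carrier := {φ | T.IsMorphism A φ}
  fun_mem {n} f φ hφ := by
    refine ⟨fun s => ?_, fun s t r hr x y hxy => ?_, fun s t g hg x => ?_⟩
    · let _ : TopologicalSpace (T.M s).obj := ⊥
      have _ : DiscreteTopology (T.M s).obj := ⟨rfl⟩
      let _ := homTopology A (T.M s)
      let F : Fin n → Hom A (T.M s) → (T.M s).obj := fun i x => φ i ⟨s, x⟩
      have h0 : ∀ i, Continuous (F i) := fun i => (hφ i).continuous s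
      have h1 : Continuous fun (x : Hom A (T.M s)) (i : Fin n) => F i x := continuous_pi h0
      exact (continuous_of_discreteTopology (f := fun z : Fin n → (T.M s).obj =>
        Structure.funMap f z)).comp h1
    · exact r.fun_mem f (fun i => ((φ i ⟨s, x⟩, φ i ⟨t, y⟩) : (T.M s).obj × (T.M t).obj))
        fun i => (hφ i).rel s t r hr x y hxy
    · have h1 : (fun i => φ i ⟨t, g.comp x⟩) = fun i => g (φ i ⟨s, x⟩) :=
        funext fun i => (hφ i).op s t g hg x
      change Structure.funMap f (fun i => φ i ⟨t, g.comp x⟩)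
        = g (Structure.funMap f fun i => φ i ⟨s, x⟩)
      rw [h1]
      exact (g.map_fun f _).symm

/-- The evaluation homomorphism `e : A → ED(A)`, `e(a)(x) = x(a)`. -/
def eval [L.IsAlgebraic] : A.obj →[L] T.ED A where
  toFun a := ⟨fun p => p.2 a, by
    refine ⟨fun s => ?_, fun s t r _ x y hxy => hxy a, fun s t g _ x => rfl⟩
    let _ : TopologicalSpace (T.M s).obj := ⊥
    let _ := homTopology A (T.M s)
    exact (continuous_apply (A := fun _ : A.obj => (T.M s).obj) a).comp
      (continuous_induced_dom (f := fun (x : Hom A (T.M s)) (a : A.obj) => x a))⟩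
  map_fun' f z := by
    apply Subtype.ext
    funext p
    exact p.2.map_fun f z
  map_rel' r := isEmptyElim r

/-- The alter ego yields a duality on the class: each evaluation homomorphism is an isomorphism
(for algebras, a bijective homomorphism). -/
def YieldsDuality [L.IsAlgebraic] : Prop :=
  ∀ A : 𝒜.Obj, Function.Bijective (T.eval A)

/-- The alter ego gives a natural duality for the class: the class is `ISP` of the sorts and the
alter ego yields a duality on it. -/
def IsNaturalDuality [L.IsAlgebraic] : Prop :=
  𝒜.mem = Alg.ISP (fun s => (T.M s).obj) ∧ T.YieldsDuality

end AlterEgo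

/-- The class has a natural duality based on a single finite algebra. -/
def AdmitsSingleSortedDuality [L.IsAlgebraic] : Prop :=
  ∃ T : 𝒜.AlterEgo, Nonempty (Unique T.S) ∧ T.IsNaturalDuality

/-! ### Piggyback dualities -/

variable {𝒜}

/-- `R_{ω₁,ω₂}`: the algebraic relations which are maximal among those contained in
`{(a, b) | ω₁ a ≤ ω₂ b}`. -/
def piggybackRel {M N : 𝒜.Obj} (ω₁ : HU M) (ω₂ : HU N) :
    Set (L.Substructure (Alg.prod M.obj N.obj)) :=
  {r | Maximal (fun r => ∀ (a : M.obj) (b : N.obj), ((a, b) : M.obj × N.obj) ∈ r →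
    ω₁.ev a ≤ ω₂.ev b) r}

variable (𝒜)

/-- A finite family of finite algebras, each with a (possibly empty) set of carrier maps. -/
structure CarrierData where
  S : Type
  finS : Finite S
  M : S → 𝒜.Obj
  finM : ∀ s, Finite (M s).obj
  Ω : ∀ s, Set (HU (M s))

namespace CarrierData

variable {𝒜} (P : 𝒜.CarrierData)

/-- The piggyback alter ego: all relations in the sets `R_{ω₁,ω₂}`, and all homomorphisms between
the sorts. -/
def alterEgo : 𝒜.AlterEgo where
  S := P.S
  finS := P.finS
  M := P.M
  finM := P.finM
  R s t := {r | ∃ ω₁ ∈ P.Ω s, ∃ ω₂ ∈ P.Ω t, r ∈ piggybackRel ω₁ ω₂}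
  G _ _ := Set.univ

/-- The separation condition. -/
def Sep : Prop :=
  ∀ (s : P.S) (a b : (P.M s).obj), a ≠ b →
    ∃ (t : P.S) (u : Hom (P.M s) (P.M t)), ∃ ω ∈ P.Ω t, ω.ev (u a) ≠ ω.ev (u b)

/-- The data give a piggyback duality for the class. -/
def IsPiggybackDuality [L.IsAlgebraic] : Prop :=
  P.Sep ∧ P.alterEgo.IsNaturalDuality

/-- `|R_{ω₁,ω₂}| ≤ 1` for each pair of carrier maps. -/
def RelLeOne : Prop :=
  ∀ s t, ∀ ω₁ ∈ P.Ω s, ∀ ω₂ ∈ P.Ω t, (piggybackRel ω₁ ω₂).encard ≤ 1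

/-- A single finite algebra with a single carrier map. -/
def simple (M : 𝒜.Obj) (hM : Finite M.obj) (ω : HU M) : 𝒜.CarrierData where
  S := Unit
  finS := inferInstance
  M _ := M
  finM _ := hM
  Ω _ := {ω}

end CarrierData

variable {𝒜}

/-- The pair `(M, ω)` gives a simple piggyback duality for the class. -/
def IsSimplePiggyback [L.IsAlgebraic] (M : 𝒜.Obj) (ω : HU M) : Prop :=
  ∃ hM : Finite M.obj, (CarrierData.simple M hM ω).IsPiggybackDuality

/-- The structure which the natural dual `D(A) = 𝒜(A, M)` induces on the Priestley space `HU(A)`: the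
relation, indexed by the endomorphisms `u` of `M`, which consists of the tuples `(ω ∘ u ∘ x)_u`,
for `x` in `D(A)`. -/
def inducedRel {M : 𝒜.Obj} (ω : HU M) (A : 𝒜.Obj) : Set (Hom M M → HU A) :=
  {τ | ∃ x : Hom A M, ∀ u : Hom M M, τ u = ω.comp (u.comp x)}

/-- The duality given by `(M, ω)` is also a duality built on the Priestley duality of the reducts.

* There is exactly one relation `r` in `R_{ω,ω}`.
* For each `A` in the class, `D(A)` with the relation lifted from `r` and with its topology gives
  the Priestley space `HU(A)`: `x ↦ ω ∘ x` is a topological quotient map onto `HU(A)` and the lifted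
  relation is the pullback of the order of `HU(A)`. Equivalently, the lifted relation is a
  pre-order, and `x ↦ ω ∘ x` induces an isomorphism of ordered spaces from the quotient of `D(A)`
  by the associated equivalence relation to `HU(A)`.
* With the structure induced from `D(A)`, the spaces `HU(A)` represent the class: the continuous
  order-preserving and structure-preserving maps `HU(B) → HU(A)` are exactly the duals of the
  homomorphisms `A → B`, each of a unique one. -/
structure IsDPBased {M : 𝒜.Obj} (ω : HU M) : Prop where
  rel : ∃ r, piggybackRel ω ω = {r} ∧
    ∀ (A : 𝒜.Obj) (x y : Hom A M), lift r x y ↔ ω.comp x ≤ ω.comp y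
  quotient : ∀ A : 𝒜.Obj,
    @Topology.IsQuotientMap (Hom A M) (HU A) (homTopology A M) _ fun x => ω.comp x
  morphisms : ∀ (A B : 𝒜.Obj) (φ : HU B → HU A),
    (Continuous φ ∧ Monotone φ ∧ ∀ τ ∈ inducedRel ω B, (fun u => φ (τ u)) ∈ inducedRel ω A) ↔
      ∃! f : Hom A B, ∀ y : HU B, φ y = y.comp f

end

end DBasedClass

/-!
The proof rests on two consequences of compactness for a compact family `Y` of bounded lattice
homomorphisms `D → 2`, that is, a compact subspace of the Priestley dual of `D`:

* a continuous map `Y → 2` which is monotone for the pointwise order is evaluation at an element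
  of `D` (`BoundedLatticeHom.exists_apply_eq_of_monotone`);
* if `Y` separates the points of `D` then `Y` is the whole dual
  (`BoundedLatticeHom.exists_eq_of_separating`).

*Piggyback dualities.* The first fact shows that finitely many finite sorts with carrier maps give a
piggyback duality as soon as the maps `ω ∘ x` separate the points of each algebra
(`Separating.yieldsDuality`): a morphism `φ` of `D(A)` determines the map `ω ∘ x ↦ ω (φ x)`, which is
well defined and monotone because `φ` preserves a maximal relation containing
`{(x a, y a) | a ∈ A}` whenever `ω ∘ x ≤ ω' ∘ y`. The converse is immediate, so the existence of a
piggyback duality is a pure separation property. Taking all carrier maps yields (i): a class has a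
single-sorted duality exactly when it is generated by one finite algebra, and the coproduct of the
non-trivial generators is such an algebra if free products exist. Coproducts in the class are
constructed as subalgebras of products of generators, which also shows that finite coproducts of
finite algebras are finite.

*Condition (E).* If `ω : M → 2` separates then `HU(A) = {ω ∘ x}` for each `A` by the second fact, so a
family of elements of the spaces `HU(K j)` comes from a single homomorphism `∐ K j → M`; hence `χ` is
injective (`Separates.condE`). Conversely, let `M` be the coproduct of copies of the generators,
one copy for each of their elements `y` of `HU`; since `χ` is injective, the family of all `y`
extends to one `ω` on `M` (`FinitelyGenerated.exists_separates`).

*Condition (S).* By the first fact `χ` is surjective if the order between the maps `ω ∘ x` on the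
coproduct is determined on the components, and this holds if all components are mapped into the
same maximal relation (`Separating.condS`). Conversely, surjectivity of `χ` for the coproduct of two
relations in `R_{ω₁,ω₂}` shows that the relation which they generate still lies in
`{(a, b) | ω₁ a ≤ ω₂ b}`, so that they coincide (`CondS.encard_piggybackRel_le_one`).

*Coproducts.* `U` preserves coproducts exactly when (E) and (S) hold: if `ω` separates, then the
initial algebra has at most one homomorphism into `M`, so its only elements are the bounds, and `χ`
is surjective for the empty family too. For a variety, the unique maximal relation `r` is a
pre-order on `M`, and `r ∩ r⁻¹` is a congruence below the kernel of `ω`; on the quotient by it the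
maps `x ↦ ω ∘ x` are injective (`ClosedUnderImages.exists_separates_injective`).
-/

/-! ### Homomorphisms from a distributive lattice to the two-element lattice -/

namespace BoundedLatticeHom

variable {D : Type*} [DistribLattice D] [BoundedOrder D]

/-- A continuous monotone map to `2` on a compact family of lattice homomorphisms is evaluation at an
element. This is the half of Priestley duality that needs only compactness: no prime ideals occur. -/
theorem exists_apply_eq_of_monotone {Y : Type*} [TopologicalSpace Y] [CompactSpace Y]
    (π : Y → BoundedLatticeHom D Bool) (hπ : ∀ a, Continuous fun y => π y a)
    (ψ : Y → Bool) (hψ : Continuous ψ)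
    (hle : ∀ y z, (∀ a, π y a ≤ π z a) → ψ y ≤ ψ z) :
    ∃ a, ∀ y, π y a = ψ y := by
  have hopen : ∀ a b, IsOpen {y | π y a = b} := fun a b =>
    (isOpen_discrete {b}).preimage (hπ a)
  have hcpt : ∀ b, IsCompact {y | ψ y = b} := fun b =>
    ((isClosed_discrete {b}).preimage hψ).isCompact
  -- Separate a single point of `ψ = 1` from all points of `ψ = 0`, by a finite meet.
  have h1 : ∀ y, ψ y = true → ∃ a, π y a = true ∧ ∀ z ∈ {z | ψ z = false}, π z a = false := by
    intro y hy
    refine (hcpt false).induction_on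
      (p := fun s => ∃ a, π y a = true ∧ ∀ z ∈ s, π z a = false) ⟨⊤, by simp, by simp⟩ ?_ ?_ ?_
    · rintro s t hst ⟨a, ha, h⟩
      exact ⟨a, ha, fun z hz => h z (hst hz)⟩
    · rintro s t ⟨a, ha, h⟩ ⟨b, hb, h'⟩
      refine ⟨a ⊓ b, by simp [ha, hb], ?_⟩
      rintro z (hz | hz)
      · simp [h z hz]
      · simp [h' z hz]
    · intro z hz
      have : ¬ ∀ a, π y a ≤ π z a := fun h => by
        have := hle y z h
        rw [hy, show ψ z = false from hz] at this
        exact absurd this (by decide)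
      push Not at this
      obtain ⟨a, ha⟩ := this
      rw [Bool.lt_iff] at ha
      exact ⟨{z | π z a = false}, mem_nhdsWithin_of_mem_nhds ((hopen a false).mem_nhds ha.1),
        a, ha.2, fun _ h => h⟩
  -- Separate all points of `ψ = 1` from all points of `ψ = 0`, by a finite join.
  have h2 : ∃ a, (∀ y ∈ {y | ψ y = true}, π y a = true) ∧ ∀ z, ψ z = false → π z a = false := by
    refine (hcpt true).induction_on
      (p := fun s => ∃ a, (∀ y ∈ s, π y a = true) ∧ ∀ z, ψ z = false → π z a = false)
      ⟨⊥, by simp, by simp⟩ ?_ ?_ ?_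
    · rintro s t hst ⟨a, ha, h⟩
      exact ⟨a, fun z hz => ha z (hst hz), h⟩
    · rintro s t ⟨a, ha, h⟩ ⟨b, hb, h'⟩
      refine ⟨a ⊔ b, ?_, fun z hz => by simp [h z hz, h' z hz]⟩
      rintro y (hy | hy)
      · simp [ha y hy]
      · simp [hb y hy]
    · intro y hy
      obtain ⟨a, ha, h⟩ := h1 y hy
      exact ⟨{y | π y a = true}, mem_nhdsWithin_of_mem_nhds ((hopen a true).mem_nhds ha),
        a, fun _ h => h, h⟩
  obtain ⟨a, ha, h⟩ := h2
  refine ⟨a, fun y => ?_⟩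
  cases hy : ψ y
  · exact h y hy
  · exact ha y hy

/-- A compact family of homomorphisms to `2` which separates the points of the lattice contains all
homomorphisms to `2`. A missing `f` would, by compactness, yield `a` and `b` with `f a = 1`, `f b = 0`
and `π y a ≤ π y b` for all `y`, hence `a ≤ b`. -/
theorem exists_eq_of_separating {Y : Type*} [TopologicalSpace Y] [CompactSpace Y]
    (π : Y → BoundedLatticeHom D Bool) (hπ : ∀ a, Continuous fun y => π y a)
    (hsep : ∀ a b, (∀ y, π y a = π y b) → a = b) (f : BoundedLatticeHom D Bool) :
    ∃ y, π y = f := by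
  by_contra! hf
  have hopen : ∀ a b, IsOpen {y | π y a = b} := fun a b =>
    (isOpen_discrete {b}).preimage (hπ a)
  obtain ⟨a, b, ha, hb, hab⟩ : ∃ a b, f a = true ∧ f b = false ∧
      ∀ z ∈ (Set.univ : Set Y), π z a ≤ π z b := by
    refine isCompact_univ.induction_on
      (p := fun s => ∃ a b, f a = true ∧ f b = false ∧ ∀ z ∈ s, π z a ≤ π z b)
      ⟨⊤, ⊥, by simp, by simp, by simp⟩ ?_ ?_ ?_
    · rintro s t hst ⟨a, b, ha, hb, h⟩
      exact ⟨a, b, ha, hb, fun z hz => h z (hst hz)⟩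
    · rintro s t ⟨a, b, ha, hb, h⟩ ⟨a', b', ha', hb', h'⟩
      refine ⟨a ⊓ a', b ⊔ b', by simp [ha, ha'], by simp [hb, hb'], ?_⟩
      rintro z (hz | hz)
      · rw [map_inf, map_sup]
        exact inf_le_left.trans ((h z hz).trans le_sup_left)
      · rw [map_inf, map_sup]
        exact inf_le_right.trans ((h' z hz).trans le_sup_right)
    · intro z _
      obtain ⟨a, ha⟩ := DFunLike.ne_iff.1 (hf z)
      cases hfa : f a
      · have hza : π z a = true := by
          rw [hfa] at ha
          simpa using ha
        refine ⟨{z | π z a = true}, mem_nhdsWithin_of_mem_nhds ((hopen a true).mem_nhds hza),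
          ⊤, a, by simp, hfa, fun z hz => ?_⟩
        rw [show π z a = true from hz]
        exact Bool.le_true _
      · have hza : π z a = false := by
          rw [hfa] at ha
          simpa using ha
        refine ⟨{z | π z a = false}, mem_nhdsWithin_of_mem_nhds ((hopen a false).mem_nhds hza),
          a, ⊥, hfa, by simp, fun z hz => ?_⟩
        rw [show π z a = false from hz]
        exact Bool.false_le _
  have hle : a ⊓ b = a := hsep _ _ fun y => by
    rw [map_inf]
    exact inf_eq_left.2 (hab y trivial)
  have := OrderHomClass.mono f (inf_eq_left.1 hle)
  rw [ha, hb] at this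
  exact absurd this (by decide)

/-- The prime ideal theorem, in terms of homomorphisms to `2`. -/
theorem exists_apply_ne_of_not_le {a b : D} (h : ¬ a ≤ b) :
    ∃ f : BoundedLatticeHom D Bool, f a = true ∧ f b = false := by
  classical
  obtain ⟨J, hJ, hbJ, haJ⟩ := DistribLattice.prime_ideal_of_disjoint_filter_ideal
    (F := Order.PFilter.principal a) (I := Order.Ideal.principal b) (by
      rw [Set.disjoint_left]
      intro x hx hx'
      exact h (le_trans (Order.PFilter.mem_principal.1 hx) hx'))
  have hinf : ∀ x y, x ⊓ y ∈ J ↔ x ∈ J ∨ y ∈ J := fun x y =>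
    ⟨hJ.mem_or_mem, fun h => h.elim (J.lower inf_le_left) (J.lower inf_le_right)⟩
  refine ⟨{ toFun := fun x => decide (x ∉ J)
            map_sup' := fun x y => ?_
            map_inf' := fun x y => ?_
            map_top' := ?_
            map_bot' := ?_ }, ?_, ?_⟩
  · by_cases hx : x ∈ J <;> by_cases hy : y ∈ J <;> simp [Order.Ideal.sup_mem_iff, hx, hy]
  · by_cases hx : x ∈ J <;> by_cases hy : y ∈ J <;> simp [hinf, hx, hy]
  · simpa using hJ.toIsProper.top_notMem
  · simp
  · have : a ∉ J := fun ha => Set.disjoint_left.1 haJ (Order.PFilter.mem_principal.2 le_rfl) ha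
    change decide (a ∉ J) = true
    simpa using this
  · have : b ∈ J := hbJ (Order.Ideal.mem_principal.2 le_rfl)
    change decide (b ∉ J) = false
    simpa using this

theorem eq_of_forall_apply_eq {a b : D} (h : ∀ f : BoundedLatticeHom D Bool, f a = f b) :
    a = b := by
  by_contra hab
  rcases not_and_or.1 (mt (fun h : a ≤ b ∧ b ≤ a => le_antisymm h.1 h.2) hab) with h' | h' <;>
  · obtain ⟨f, h1, h2⟩ := exists_apply_ne_of_not_le h'
    have := h f
    simp [h1, h2] at this

variable (D) in
/-- The topology of pointwise convergence on the homomorphisms to `2`, as on a Priestley dual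
space. -/
@[reducible] noncomputable def pointwiseTopology : TopologicalSpace (BoundedLatticeHom D Bool) :=
  TopologicalSpace.induced (fun f a => f a) inferInstance

variable (D) in
theorem isClosed_range_coe :
    IsClosed (Set.range fun (f : BoundedLatticeHom D Bool) (a : D) => f a) := by
  have : (Set.range fun (f : BoundedLatticeHom D Bool) (a : D) => f a) =
      {g | (∀ a b, g (a ⊔ b) = g a ⊔ g b) ∧ (∀ a b, g (a ⊓ b) = g a ⊓ g b) ∧
        g ⊤ = true ∧ g ⊥ = false} := by
    ext g
    constructor
    · rintro ⟨f, rfl⟩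
      exact ⟨map_sup f, map_inf f, map_top f, map_bot f⟩
    · rintro ⟨h1, h2, h3, h4⟩
      exact ⟨⟨⟨⟨g, h1⟩, h2⟩, h3, h4⟩, rfl⟩
  rw [this]
  simp only [Set.ofPred_and, Set.ofPred_forall]
  have c2 : ∀ (op : Bool → Bool → Bool) (a b : D), Continuous fun g : D → Bool => op (g a) (g b) :=
    fun op a b => (continuous_of_discreteTopology (f := fun p : Bool × Bool => op p.1 p.2)).comp
      ((continuous_apply (A := fun _ : D => Bool) a).prodMk (continuous_apply b))
  refine IsClosed.inter ?_ (IsClosed.inter ?_ (IsClosed.inter ?_ ?_))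
  · exact isClosed_iInter fun a => isClosed_iInter fun b =>
      isClosed_eq (continuous_apply _) (c2 (· ⊔ ·) a b)
  · exact isClosed_iInter fun a => isClosed_iInter fun b =>
      isClosed_eq (continuous_apply _) (c2 (· ⊓ ·) a b)
  · exact isClosed_eq (continuous_apply _) continuous_const
  · exact isClosed_eq (continuous_apply _) continuous_const

variable (D) in
theorem compactSpace_pointwise : @CompactSpace _ (pointwiseTopology D) := by
  let _ := pointwiseTopology D
  have hi : Topology.IsInducing (fun (f : BoundedLatticeHom D Bool) (a : D) => f a) := ⟨rfl⟩
  refine ⟨hi.isCompact_iff.2 ?_⟩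
  rw [Set.image_univ]
  exact (isClosed_range_coe D).isCompact

variable (D) in
theorem continuous_eval (a : D) :
    @Continuous _ _ (pointwiseTopology D) _ fun f : BoundedLatticeHom D Bool => f a := by
  let _ := pointwiseTopology D
  exact (continuous_apply a).comp
    (continuous_induced_dom (f := fun (f : BoundedLatticeHom D Bool) (a : D) => f a))

/-- Homomorphisms to `2` extend along lattice embeddings. -/
theorem exists_comp_eq {E : Type*} [DistribLattice E] [BoundedOrder E]
    (i : BoundedLatticeHom D E) (hi : Function.Injective i) (f : BoundedLatticeHom D Bool) :
    ∃ g : BoundedLatticeHom E Bool, g.comp i = f := by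
  let _ := pointwiseTopology E
  have _ := compactSpace_pointwise E
  exact exists_eq_of_separating (fun g : BoundedLatticeHom E Bool => g.comp i)
    (fun a => continuous_eval E (i a))
    (fun a b h => hi (eq_of_forall_apply_eq fun g => h g)) f

end BoundedLatticeHom

/-! ### Coproducts of bounded distributive lattices -/

namespace BddDistLat

/-- The coproduct is realised inside the power `2 ^ X`, where `X` is the product of the dual spaces of
the components, as the bounded sublattice generated by the images of the components. -/
theorem exists_coproduct {J : Type u} (K : J → BddDistLat.{u}) :
    ∃ d : Cofan K, Nonempty (IsColimit d) := by
  let X : Type u := ∀ j, BoundedLatticeHom (K j) Bool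
  let ι : ∀ j, K j → X → Bool := fun j a x => x j a
  let T : Sublattice (X → Bool) := 
    sInf {S | ⊥ ∈ S ∧ ⊤ ∈ S ∧ ∀ j a, ι j a ∈ S}
  have hbot : (⊥ : X → Bool) ∈ T := Sublattice.mem_sInf.2 fun S hS => hS.1
  have htop : (⊤ : X → Bool) ∈ T := Sublattice.mem_sInf.2 fun S hS => hS.2.1
  have hι : ∀ j a, ι j a ∈ T := fun j a =>
    Sublattice.mem_sInf.2 fun S hS => hS.2.2 j a
  let _ : BoundedOrder T :=
    { top := ⟨⊤, htop⟩, le_top := fun a => (le_top : a.1 ≤ ⊤)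
      bot := ⟨⊥, hbot⟩, bot_le := fun a => (bot_le : ⊥ ≤ a.1) }
  let inj : ∀ j, K j ⟶ BddDistLat.of T := fun j => BddDistLat.ofHom
    { toFun := fun a => ⟨ι j a, hι j a⟩
      map_sup' := fun a b => Subtype.ext (funext fun x => map_sup (x j) a b)
      map_inf' := fun a b => Subtype.ext (funext fun x => map_inf (x j) a b)
      map_top' := Subtype.ext (funext fun x => map_top (x j))
      map_bot' := Subtype.ext (funext fun x => map_bot (x j)) }
  have hind : ∀ S : Sublattice (X → Bool), ⊥ ∈ S → ⊤ ∈ S → (∀ j a, ι j a ∈ S) →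
      ∀ t : T, t.1 ∈ S := by
    exact fun S h1 h2 h3 t => Sublattice.mem_sInf.1 t.2 S ⟨h1, h2, h3⟩
  have hext : ∀ (E : BddDistLat.{u}) (f f' : BoundedLatticeHom T E),
      (∀ j a, f ⟨ι j a, hι j a⟩ = f' ⟨ι j a, hι j a⟩) → ∀ t, f t = f' t := by
    intro E f f' h t
    refine (hind
      { carrier := {t | ∃ ht : t ∈ T, f ⟨t, ht⟩ = f' ⟨t, ht⟩}
        supClosed' := ?_
        infClosed' := ?_ } ⟨hbot, ?_⟩ ⟨htop, ?_⟩ (fun j a => ⟨hι j a, h j a⟩) t).2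
    · rintro a ⟨ha, he⟩ b ⟨hb, he'⟩
      refine ⟨T.sup_mem ha hb, ?_⟩
      change f (⟨a, ha⟩ ⊔ ⟨b, hb⟩) = f' (⟨a, ha⟩ ⊔ ⟨b, hb⟩)
      rw [map_sup, map_sup, he, he']
    · rintro a ⟨ha, he⟩ b ⟨hb, he'⟩
      refine ⟨T.inf_mem ha hb, ?_⟩
      change f (⟨a, ha⟩ ⊓ ⟨b, hb⟩) = f' (⟨a, ha⟩ ⊓ ⟨b, hb⟩)
      rw [map_inf, map_inf, he, he']
    · exact (map_bot f).trans (map_bot f').symm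
    · exact (map_top f).trans (map_top f').symm
  refine ⟨Cofan.mk (BddDistLat.of T) inj, ⟨?_⟩⟩
  -- An element `t` is sent to the element of `s.pt` whose values under the homomorphisms to `2` are
  -- given by `t`; it is unique because these homomorphisms separate points.
  have key : ∀ (s : Cofan K) (t : T), ∃ e : s.pt, ∀ g : BoundedLatticeHom s.pt Bool,
      g e = t.1 fun j => g.comp (s.inj j).hom := by
    intro s t
    refine hind
      { carrier := {t | ∃ e : s.pt, ∀ g : BoundedLatticeHom s.pt Bool,
          g e = t fun j => g.comp (s.inj j).hom}
        supClosed' := ?_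
        infClosed' := ?_ } ⟨⊥, fun g => map_bot g⟩ ⟨⊤, fun g => map_top g⟩
        (fun j a => ⟨(s.inj j).hom a, fun g => rfl⟩) t
    · rintro a ⟨e, he⟩ b ⟨e', he'⟩
      exact ⟨e ⊔ e', fun g => by rw [map_sup, he, he']; rfl⟩
    · rintro a ⟨e, he⟩ b ⟨e', he'⟩
      exact ⟨e ⊓ e', fun g => by rw [map_inf, he, he']; rfl⟩
  choose desc hdesc using key
  refine Cofan.IsColimit.mk _ (fun s => BddDistLat.ofHom (X := T)
    { toFun := desc s
      map_sup' := fun a b => BoundedLatticeHom.eq_of_forall_apply_eq fun g => by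
        rw [map_sup, hdesc, hdesc, hdesc]; rfl
      map_inf' := fun a b => BoundedLatticeHom.eq_of_forall_apply_eq fun g => by
        rw [map_inf, hdesc, hdesc, hdesc]; rfl
      map_top' := BoundedLatticeHom.eq_of_forall_apply_eq fun g => by
        rw [map_top, hdesc]; rfl
      map_bot' := BoundedLatticeHom.eq_of_forall_apply_eq fun g => by
        rw [map_bot, hdesc]; rfl }) (fun s j => ?_) fun s m hm => ?_
  · ext a
    exact BoundedLatticeHom.eq_of_forall_apply_eq fun g => hdesc s ⟨ι j a, hι j a⟩ g
  · ext t
    refine hext s.pt m.hom _ (fun j a => ?_) t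
    exact (congrArg (fun k => k.hom a) (hm j)).trans
      (BoundedLatticeHom.eq_of_forall_apply_eq fun g => hdesc s ⟨ι j a, hι j a⟩ g).symm

/-- Inequalities between homomorphisms to `2` can be checked on the components of a coproduct: the
elements where the inequality holds form a bounded sublattice. -/
theorem le_of_isColimit {J : Type u} {K : J → BddDistLat.{u}} {d : Cofan K} (hd : IsColimit d)
    (f g : BoundedLatticeHom d.pt Bool)
    (h : ∀ j a, f ((d.inj j).hom a) ≤ g ((d.inj j).hom a)) (b : d.pt) : f b ≤ g b := by
  let T : Sublattice d.pt :=
    { carrier := {b | f b ≤ g b}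
      supClosed' := fun a ha b hb => by
        change f (a ⊔ b) ≤ g (a ⊔ b)
        rw [map_sup, map_sup]
        exact sup_le_sup ha hb
      infClosed' := fun a ha b hb => by
        change f (a ⊓ b) ≤ g (a ⊓ b)
        rw [map_inf, map_inf]
        exact inf_le_inf ha hb }
  let _ : BoundedOrder T :=
    { top := ⟨⊤, ((map_top f).trans (map_top g).symm).le⟩, le_top := fun a => (le_top : a.1 ≤ ⊤)
      bot := ⟨⊥, ((map_bot f).trans (map_bot g).symm).le⟩, bot_le := fun a => (bot_le : ⊥ ≤ a.1) }
  let incl : BddDistLat.of T ⟶ d.pt := BddDistLat.ofHom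
    { T.subtype with map_top' := rfl, map_bot' := rfl }
  let p : d.pt ⟶ BddDistLat.of T := Cofan.IsColimit.desc hd fun j => BddDistLat.ofHom
    { toFun := fun a => ⟨(d.inj j).hom a, h j a⟩
      map_sup' := fun a b => Subtype.ext (map_sup (d.inj j).hom a b)
      map_inf' := fun a b => Subtype.ext (map_inf (d.inj j).hom a b)
      map_top' := Subtype.ext (map_top (d.inj j).hom)
      map_bot' := Subtype.ext (map_bot (d.inj j).hom) }
  have hp : p ≫ incl = 𝟙 _ := by
    refine Cofan.IsColimit.hom_ext hd _ _ fun j => ?_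
    rw [← Category.assoc, Cofan.IsColimit.fac, Category.comp_id]
    rfl
  have hb : (p.hom b).1 = b := congrArg (fun k => k.hom b) hp
  have := (p.hom b).2
  rwa [hb] at this

/-- The universal property of a coproduct for homomorphisms to `2`. -/
theorem exists_desc_bool {J : Type u} {K : J → BddDistLat.{u}} {d : Cofan K} (hd : IsColimit d)
    (f : ∀ j, BoundedLatticeHom (K j) Bool) :
    ∃ y : BoundedLatticeHom d.pt Bool, ∀ j a, y ((d.inj j).hom a) = f j a := by
  -- The two-element lattice is replaced by a copy in the universe of the components.
  let F : ∀ j, K j ⟶ BddDistLat.of (PUnit.{u + 1} → Bool) := fun j => BddDistLat.ofHom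
    { toFun := fun a _ => f j a
      map_sup' := fun a b => funext fun _ => map_sup (f j) a b
      map_inf' := fun a b => funext fun _ => map_inf (f j) a b
      map_top' := funext fun _ => map_top (f j)
      map_bot' := funext fun _ => map_bot (f j) }
  let G : BoundedLatticeHom d.pt (PUnit.{u + 1} → Bool) := (Cofan.IsColimit.desc hd F).hom
  refine ⟨{ toFun := fun b => G b PUnit.unit
            map_sup' := fun a b => congrFun (map_sup G a b) _
            map_inf' := fun a b => congrFun (map_inf G a b) _
            map_top' := congrFun (map_top G) _
            map_bot' := congrFun (map_bot G) _ }, fun j a => ?_⟩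
  exact congrArg (fun k => k.hom a PUnit.unit) (Cofan.IsColimit.fac hd F j)

end BddDistLat

/-! ### Homomorphisms, products and quotients of algebras -/

namespace Alg

variable {L : FirstOrder.Language.{v, w}} [L.IsAlgebraic]

/-- A homomorphism of algebras from a map which preserves the operations. -/
def homMk {A B : Type*} [L.Structure A] [L.Structure B] (f : A → B)
    (hf : ∀ {n} (g : L.Functions n) (x : Fin n → A),
      f (Structure.funMap g x) = Structure.funMap g (f ∘ x)) : A →[L] B where
  toFun := f
  map_fun' := hf
  map_rel' r := isEmptyElim r

/-- The first projection of a product of two algebras. -/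
def fst (A B : Alg.{v, w, u} L) : prod A B →[L] A := homMk Prod.fst fun _ _ => rfl

/-- The second projection of a product of two algebras. -/
def snd (A B : Alg.{v, w, u} L) : prod A B →[L] B := homMk Prod.snd fun _ _ => rfl

/-- The homomorphism into a product with components `x` and `y`. -/
def pair {A B C : Alg.{v, w, u} L} (x : A →[L] B) (y : A →[L] C) : A →[L] prod B C :=
  homMk (fun a => ((x a, y a) : B × C)) fun f z => Prod.ext (x.map_fun f z) (y.map_fun f z)

/-- `ISP(M)` consists of the algebras whose points are separated by the homomorphisms to members of
`M`. -/
theorem ISP_iff {S : Type} {M : S → Alg.{v, w, u} L} {A : Alg.{v, w, u} L} :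
    ISP M A ↔ ∀ a b : A, (∀ s (x : A →[L] M s), x a = x b) → a = b := by
  constructor
  · rintro ⟨I, k, ⟨e⟩⟩ a b h
    refine e.injective (funext fun i => ?_)
    exact h (k i) (homMk (fun a => e a i) fun f z => congrFun (e.map_fun f z) i)
  · intro h
    refine ⟨Σ s, A →[L] M s, fun i => i.1, ⟨?_⟩⟩
    exact
      { toFun := fun a i => i.2 a
        inj' := fun a b hab => h a b fun s x => congrFun hab ⟨s, x⟩
        map_fun' := fun f z => funext fun i => i.2.map_fun f z
        map_rel' := fun r => isEmptyElim r }

/-- The quotient of an algebra. The operations are computed on chosen representatives, so that the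
projection is a homomorphism only if `s` is a congruence. -/
noncomputable def quotient (A : Alg.{v, w, u} L) (s : Setoid A) : Alg.{v, w, u} L where
  carrier := Quotient s
  str :=
    { funMap := fun f x => Quotient.mk s (Structure.funMap f fun i => (x i).out)
      RelMap := fun r => isEmptyElim r }

instance finite_hom {A B : Type*} [L.Structure A] [L.Structure B] [Finite A] [Finite B] :
    Finite (A →[L] B) :=
  Finite.of_injective (fun x a => x a) DFunLike.coe_injective

end Alg

namespace DBasedClass

variable {L : FirstOrder.Language.{v, w}} {𝒜 : DBasedClass.{v, w, u} L}

theorem exists_hom_of_isColimit {J : Type u} {K : J → 𝒜.Obj} {c : Cofan K} (hc : IsColimit c)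
    {A : 𝒜.Obj} (x : ∀ j, Hom (K j) A) :
    ∃ z : Hom c.pt A, ∀ j a, z (toHom (c.inj j) a) = x j a := by
  refine ⟨(Cofan.IsColimit.desc hc fun j => (⟨x j⟩ : K j ⟶ A)).hom, fun j a => ?_⟩
  have := Cofan.IsColimit.fac hc (fun j => (⟨x j⟩ : K j ⟶ A)) j
  exact congrArg (fun k : K j ⟶ A => (toHom k) a) this

theorem hom_ext_of_isColimit {J : Type u} {K : J → 𝒜.Obj} {c : Cofan K} (hc : IsColimit c)
    {A : 𝒜.Obj} {z z' : Hom c.pt A}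
    (h : ∀ j a, z (toHom (c.inj j) a) = z' (toHom (c.inj j) a)) : z = z' := by
  have : (⟨z⟩ : c.pt ⟶ A) = ⟨z'⟩ := Cofan.IsColimit.hom_ext hc _ _ fun j =>
    ObjectProperty.hom_ext _ (FirstOrder.Language.Hom.ext (h j))
  exact congrArg (fun k : c.pt ⟶ A => toHom k) this

variable [L.IsAlgebraic]

theorem mem_iff {S : Type} {M : S → Alg.{v, w, u} L} (h : 𝒜.mem = Alg.ISP M)
    {A : Alg.{v, w, u} L} :
    𝒜.mem A ↔ ∀ a b : A, (∀ s (x : A →[L] M s), x a = x b) → a = b := by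
  rw [h, Alg.ISP_iff]

/-- A finitely generated quasivariety is closed under `ISP`. -/
theorem FinitelyGenerated.mem_of_separating (h𝒜 : 𝒜.FinitelyGenerated) {A : Alg.{v, w, u} L}
    (hA : ∀ a b : A, (∀ (B : 𝒜.Obj) (x : A →[L] B.obj), x a = x b) → a = b) : 𝒜.mem A := by
  obtain ⟨S, _, M, _, h⟩ := h𝒜
  refine (mem_iff h).2 fun a b hab => hA a b fun B x => ?_
  exact (mem_iff h).1 B.property _ _ fun s y => hab s (y.comp x)

theorem eq_ISP_of_separating {S : Type} {M : S → 𝒜.Obj}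
    (hfg : 𝒜.FinitelyGenerated)
    (h : ∀ (A : 𝒜.Obj) (a b : A.obj), (∀ s (x : Hom A (M s)), x a = x b) → a = b) :
    𝒜.mem = Alg.ISP fun s => (M s).obj := by
  ext A
  rw [Alg.ISP_iff]
  refine ⟨fun hA => h ⟨A, hA⟩, fun hA => hfg.mem_of_separating fun a b hab => ?_⟩
  exact hA a b fun s x => hab (M s) x

/-- A subalgebra of a member of the class, as a member of the class. -/
def FinitelyGenerated.sub (h𝒜 : 𝒜.FinitelyGenerated) (A : 𝒜.Obj) (T : L.Substructure A.obj) :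
    𝒜.Obj :=
  ⟨⟨T⟩, h𝒜.mem_of_separating fun _ _ hab => Subtype.ext (hab A T.subtype.toHom)⟩

/-- The product of two members of the class, as a member of the class. -/
def FinitelyGenerated.prod (h𝒜 : 𝒜.FinitelyGenerated) (A B : 𝒜.Obj) : 𝒜.Obj :=
  ⟨Alg.prod A.obj B.obj, h𝒜.mem_of_separating fun _ _ hab =>
    Prod.ext (hab A (Alg.fst _ _)) (hab B (Alg.snd _ _))⟩

/-! ### Coproducts in the class -/

/-- A coproduct is generated by the images of its components. -/
theorem mem_of_isColimit (h𝒜 : 𝒜.FinitelyGenerated) {J : Type u} {K : J → 𝒜.Obj} {c : Cofan K}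
    (hc : IsColimit c) (T : L.Substructure c.pt.obj) (h : ∀ j a, toHom (c.inj j) a ∈ T)
    (a : c.pt.obj) : a ∈ T := by
  obtain ⟨z, hz⟩ := exists_hom_of_isColimit hc (A := h𝒜.sub c.pt T) fun j =>
    Alg.homMk (fun a => (⟨toHom (c.inj j) a, h j a⟩ : T))
      fun f x => Subtype.ext ((toHom (c.inj j)).map_fun f x)
  have h1 : (T.subtype.toHom.comp z : Hom c.pt c.pt) = FirstOrder.Language.Hom.id L _ :=
    hom_ext_of_isColimit hc fun j a => congrArg Subtype.val (hz j a)
  have h2 : (z a).1 = a := congrArg (fun k : Hom c.pt c.pt => k a) h1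
  exact h2 ▸ (z a).2

/-- Consider the product which has one factor `M s` for each generator `M s` and each family of
homomorphisms from all components to `M s`. The coproduct is the subalgebra of this product generated
by the images of the components. For a finite family of finite algebras the product is finite. -/
theorem FinitelyGenerated.exists_coproduct (h𝒜 : 𝒜.FinitelyGenerated) {J : Type u}
    (K : J → 𝒜.Obj) : ∃ c : Cofan K, Nonempty (IsColimit c) ∧
      (Finite J → (∀ j, Finite (K j).obj) → Finite c.pt.obj) := by
  obtain ⟨S, _, M, hM, h⟩ := h𝒜
  let I : Type u := Σ s, ∀ j, (K j).obj →[L] M s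
  let P : Alg.{v, w, u} L := Alg.pi fun i : I => M i.1
  let ι : ∀ j, (K j).obj →[L] P := fun j =>
    Alg.homMk (fun a i => i.2 j a) fun f x => funext fun i => (i.2 j).map_fun f x
  let T : L.Substructure P := Substructure.closure L (⋃ j, Set.range (ι j))
  have hι : ∀ j a, ι j a ∈ T := fun j a =>
    Substructure.subset_closure (Set.mem_iUnion.2 ⟨j, a, rfl⟩)
  have hind : ∀ S : L.Substructure P, (∀ j a, ι j a ∈ S) → ∀ t : T, t.1 ∈ S := by
    intro S hS t
    refine Substructure.closure_le.2 ?_ t.2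
    intro x hx
    obtain ⟨j, a, rfl⟩ := Set.mem_iUnion.1 hx
    exact hS j a
  have hT : 𝒜.mem ⟨T⟩ := (mem_iff h).2 fun a b hab => Subtype.ext <| funext fun i =>
    hab i.1 (Alg.homMk (fun t : T => t.1 i) fun f x => rfl)
  let C : 𝒜.Obj := ⟨⟨T⟩, hT⟩
  let inj : ∀ j, K j ⟶ C := fun j => ⟨(Alg.homMk (fun a => (⟨ι j a, hι j a⟩ : T))
      fun f x => Subtype.ext ((ι j).map_fun f x) : Hom (K j) C)⟩
  -- An element `t` is sent to the element of `s.pt` whose values under the homomorphisms to the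
  -- generators are given by `t`; it is unique because these homomorphisms separate points.
  have key : ∀ (s : Cofan K) (t : T), ∃ e : s.pt.obj, ∀ k (x : s.pt.obj →[L] M k),
      x e = t.1 ⟨k, fun j => x.comp (toHom (s.inj j))⟩ := by
    intro s t
    refine hind
      { carrier := {t | ∃ e : s.pt.obj, ∀ k (x : s.pt.obj →[L] M k),
          x e = t ⟨k, fun j => x.comp (toHom (s.inj j))⟩}
        fun_mem := fun {n} f x hx => ?_ } (fun j a => ⟨toHom (s.inj j) a, fun k x => rfl⟩) t
    choose e he using hx
    refine ⟨Structure.funMap f e, fun k x => ?_⟩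
    rw [x.map_fun]
    exact congrArg (Structure.funMap f) (funext fun i => he i k x)
  choose desc hdesc using key
  refine ⟨Cofan.mk C inj, ⟨Cofan.IsColimit.mk _ (fun s => ⟨(Alg.homMk (desc s) fun {n} f x => ?_ :
    Hom C s.pt)⟩) (fun s j => ?_) fun s m hm => ?_⟩, fun _ hK => ?_⟩
  · refine (mem_iff h).1 s.pt.property _ _ fun k y => ?_
    rw [hdesc, y.map_fun]
    exact congrArg (Structure.funMap f) (funext fun i => (hdesc s (x i) k y).symm)
  · refine ObjectProperty.hom_ext _ (FirstOrder.Language.Hom.ext fun a => ?_)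
    exact (mem_iff h).1 s.pt.property _ _ fun k y => hdesc s ⟨ι j a, hι j a⟩ k y
  · refine ObjectProperty.hom_ext _ (FirstOrder.Language.Hom.ext fun t => ?_)
    refine (mem_iff h).1 s.pt.property _ _ fun k y => ?_
    refine Eq.trans ?_ (hdesc s t k y).symm
    let m' : T →[L] s.pt.obj := toHom m
    refine (hind
      { carrier := {t | ∃ ht : t ∈ T, y (m' ⟨t, ht⟩) = t ⟨k, fun j => y.comp (toHom (s.inj j))⟩}
        fun_mem := fun {n} f x hx => ?_ } (fun j a => ⟨hι j a, ?_⟩) t).2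
    · choose h1 h2 using hx
      refine ⟨T.fun_mem f x h1, ?_⟩
      have e1 : (⟨Structure.funMap f x, T.fun_mem f x h1⟩ : T) =
        Structure.funMap f fun i => (⟨x i, h1 i⟩ : T) := rfl
      rw [e1, m'.map_fun, y.map_fun]
      exact congrArg (Structure.funMap f) (funext h2)
    · exact congrArg (fun k : K j ⟶ s.pt => y (toHom k a)) (hm j)
  · have _ := hM
    have _ : Finite I := inferInstance
    have _ : Finite P := inferInstanceAs (Finite (∀ i : I, M i.1))
    exact inferInstanceAs (Finite T)

theorem finite_of_isColimit (h𝒜 : 𝒜.FinitelyGenerated) {J : Type u} {K : J → 𝒜.Obj} {c : Cofan K}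
    (hc : IsColimit c) [Finite J] (hK : ∀ j, Finite (K j).obj) : Finite c.pt.obj := by
  obtain ⟨c', ⟨hc'⟩, hfin⟩ := h𝒜.exists_coproduct K
  have := hfin inferInstance hK
  obtain ⟨z, hz⟩ := exists_hom_of_isColimit hc fun j => toHom (c'.inj j)
  obtain ⟨y, hy⟩ := exists_hom_of_isColimit hc' fun j => toHom (c.inj j)
  have h1 : (y.comp z : Hom c.pt c.pt) = FirstOrder.Language.Hom.id L _ :=
    hom_ext_of_isColimit hc fun j a => by
      change y (z _) = _
      rw [hz, hy]
      rfl
  exact Finite.of_injective z (Function.LeftInverse.injective (g := y)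
    fun a => congrArg (fun k : Hom c.pt c.pt => k a) h1)

end DBasedClass

namespace DBasedClass

variable {L : FirstOrder.Language.{v, w}} {𝒜 : DBasedClass.{v, w, u} L}

/-! ### The spaces `HU(A)` and `D(A)` -/

namespace HU

theorem ext {A : 𝒜.Obj} {y z : HU A} (h : ∀ a, y.ev a = z.ev a) : y = z :=
  ev_injective A (funext h)

theorem eq_of_forall_ev_eq {A : 𝒜.Obj} {a b : A.obj} (h : ∀ y : HU A, y.ev a = y.ev b) : a = b :=
  BoundedLatticeHom.eq_of_forall_apply_eq (D := 𝒜.U.obj A) h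

instance {A : 𝒜.Obj} [Finite A.obj] : Finite (HU A) := Finite.of_injective ev (ev_injective A)

theorem continuous_ev {A : 𝒜.Obj} (a : A.obj) : Continuous fun y : HU A => y.ev a :=
  (continuous_apply a).comp continuous_induced_dom

instance compactSpace (A : 𝒜.Obj) : CompactSpace (HU A) :=
  BoundedLatticeHom.compactSpace_pointwise (𝒜.U.obj A)

instance t2Space (A : 𝒜.Obj) : T2Space (HU A) :=
  T2Space.of_injective_continuous (ev_injective A) continuous_induced_dom

end HU

/-- Here `ω` may be any map: the topology of `Hom A M` comes from the discrete topology of `M`. -/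
theorem continuous_ev_hom {A M : 𝒜.Obj} (ω : M.obj → Bool) (a : A.obj) :
    @Continuous (Hom A M) Bool (homTopology A M) _ fun x => ω (x a) := by
  let _ : TopologicalSpace M.obj := ⊥
  have _ : DiscreteTopology M.obj := ⟨rfl⟩
  let _ := homTopology A M
  exact (continuous_of_discreteTopology (f := ω)).comp
    ((continuous_apply (A := fun _ : A.obj => M.obj) a).comp
      (continuous_induced_dom (f := fun (x : Hom A M) (a : A.obj) => x a)))

/-- The homomorphisms form a closed subset of the compact power `M ^ A`, as `M` is finite. -/
theorem compactSpace_hom [L.IsAlgebraic] (A M : 𝒜.Obj) [Finite M.obj] :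
    @CompactSpace (Hom A M) (homTopology A M) := by
  let _ : TopologicalSpace M.obj := ⊥
  have _ : DiscreteTopology M.obj := ⟨rfl⟩
  let _ := homTopology A M
  have hi : Topology.IsInducing (fun (x : Hom A M) (a : A.obj) => x a) := ⟨rfl⟩
  refine ⟨hi.isCompact_iff.2 ?_⟩
  rw [Set.image_univ]
  refine IsClosed.isCompact ?_
  have : (Set.range fun (x : Hom A M) (a : A.obj) => x a) =
      {g | ∀ n (f : L.Functions n) (z : Fin n → A.obj),
        g (Structure.funMap f z) = Structure.funMap f fun i => g (z i)} := by
    ext g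
    constructor
    · rintro ⟨x, rfl⟩ n f z
      exact x.map_fun f z
    · intro h
      exact ⟨Alg.homMk g fun f z => h _ f z, rfl⟩
  rw [this]
  simp only [Set.ofPred_forall]
  refine isClosed_iInter fun n => isClosed_iInter fun f => isClosed_iInter fun z =>
    isClosed_eq (continuous_apply _) ?_
  exact (continuous_of_discreteTopology (f := fun t : Fin n → M.obj => Structure.funMap f t)).comp
    (continuous_pi fun i => continuous_apply (z i))

/-- The carrier map `ω` on `M` separates: for each `A` in the class, the maps `ω ∘ x`, for
`x : A → M`, separate the points of `A`. -/
def Separates {M : 𝒜.Obj} (ω : HU M) : Prop :=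
  ∀ (A : 𝒜.Obj) (a b : A.obj), (∀ x : Hom A M, ω.ev (x a) = ω.ev (x b)) → a = b

/-! ### The maps `χ` -/

/-- The defining property of `χ`. -/
theorem χ_inj {J : Type u} {K : J → 𝒜.Obj} (c : Cofan K) {d : Cofan fun j => 𝒜.U.obj (K j)}
    (hd : IsColimit d) (j : J) (a : (K j).obj) :
    (χ c hd).hom ((d.inj j).hom a) = toHom (c.inj j) a :=
  congrArg (fun k => k.hom a) (Cofan.IsColimit.fac hd (fun j => 𝒜.U.map (c.inj j)) j)

theorem χ_bijective {J : Type u} {K : J → 𝒜.Obj} (c : Cofan K)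
    {d : Cofan fun j => 𝒜.U.obj (K j)} (hd : IsColimit d)
    (hc : IsColimit (Cofan.mk (𝒜.U.obj c.pt) fun j => 𝒜.U.map (c.inj j))) :
    Function.Bijective (χ c hd) := by
  let ψ : 𝒜.U.obj c.pt ⟶ d.pt := Cofan.IsColimit.desc hc d.inj
  have h1 : χ c hd ≫ ψ = 𝟙 _ := Cofan.IsColimit.hom_ext hd _ _ fun j => by
    rw [← Category.assoc, χ, Cofan.IsColimit.fac, Category.comp_id]
    exact Cofan.IsColimit.fac hc d.inj j
  have h2 : ψ ≫ χ c hd = 𝟙 _ := Cofan.IsColimit.hom_ext hc _ _ fun j => by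
    rw [← Category.assoc]
    refine (congrArg (· ≫ χ c hd) (Cofan.IsColimit.fac hc d.inj j)).trans ?_
    rw [χ, Cofan.IsColimit.fac]
    exact (Category.comp_id _).symm
  exact Function.bijective_iff_has_inverse.2
    ⟨ψ, fun b => congrArg (fun k => k.hom b) h1, fun b => congrArg (fun k => k.hom b) h2⟩

theorem nonempty_isColimit_of_χ_bijective {J : Type u} {K : J → 𝒜.Obj} (c : Cofan K)
    {d : Cofan fun j => 𝒜.U.obj (K j)} (hd : IsColimit d) (h : Function.Bijective (χ c hd)) :
    Nonempty (IsColimit (Cofan.mk (𝒜.U.obj c.pt) fun j => 𝒜.U.map (c.inj j))) := by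
  let f : BoundedLatticeHom d.pt (𝒜.U.obj c.pt) := (χ c hd).hom
  let e : d.pt ≃o 𝒜.U.obj c.pt :=
    { Equiv.ofBijective f h with
      map_rel_iff' := fun {a b} => by
        change f a ≤ f b ↔ a ≤ b
        rw [← sup_eq_right, ← map_sup, h.1.eq_iff, sup_eq_right] }
  exact ⟨IsColimit.ofIsoColimit hd (Cofan.ext (BddDistLat.Iso.mk e)
    fun j => Cofan.IsColimit.fac hd _ j)⟩

/-- An element of the dual space factors through each quotient map whose kernel lies below its own. -/
theorem exists_comp_eq_of_surjective {A B : 𝒜.Obj} (f : Hom A B) (hf : Function.Surjective f)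
    (y : HU A) (hy : ∀ a b, f a = f b → y.ev a = y.ev b) : ∃ z : HU B, z.comp f = y := by
  let g : BoundedLatticeHom (𝒜.U.obj A) (𝒜.U.obj B) := (𝒜.U.map ⟨f⟩).hom
  let y' : BoundedLatticeHom (𝒜.U.obj A) Bool := y
  have hg : ∀ b, ∃ a, g a = b := hf
  choose s hs using hg
  have hys : ∀ a, y' (s (g a)) = y' a := fun a => hy _ _ (hs _)
  let z : BoundedLatticeHom (𝒜.U.obj B) Bool :=
    { toFun := fun b => y' (s b)
      map_sup' := fun a b => by
        rw [← map_sup, ← hys (s a ⊔ s b), map_sup g, hs, hs]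
      map_inf' := fun a b => by
        rw [← map_inf, ← hys (s a ⊓ s b), map_inf g, hs, hs]
      map_top' := by rw [← map_top g, hys, map_top]
      map_bot' := by rw [← map_bot g, hys, map_bot] }
  exact ⟨z, HU.ext hys⟩

/-- The empty case of (S) follows from separation: the initial algebra has only one homomorphism to
`M`, hence no other elements than its bounds. -/
theorem Separates.surjective_χ_of_isEmpty {M : 𝒜.Obj} {ω : HU M} (hω : Separates ω) {J : Type u}
    [IsEmpty J] {K : J → 𝒜.Obj} {c : Cofan K} (hc : IsColimit c)
    {d : Cofan fun j => 𝒜.U.obj (K j)} (hd : IsColimit d) : Function.Surjective (χ c hd) := by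
  intro a
  obtain ⟨x, -⟩ := exists_hom_of_isColimit hc (A := M) isEmptyElim
  have hx : ∀ y : Hom c.pt M, y = x := fun y => hom_ext_of_isColimit hc isEmptyElim
  let f : BoundedLatticeHom d.pt (𝒜.U.obj c.pt) := (χ c hd).hom
  let z : BoundedLatticeHom (𝒜.U.obj c.pt) Bool := ω.comp x
  cases h : (ω.comp x).ev a
  · refine ⟨⊥, hω _ _ _ fun y => ?_⟩
    rw [hx y]
    exact ((congrArg z (map_bot f)).trans (map_bot z)).trans h.symm
  · refine ⟨⊤, hω _ _ _ fun y => ?_⟩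
    rw [hx y]
    exact ((congrArg z (map_top f)).trans (map_top z)).trans h.symm

theorem PreservesCoproducts.χ_bijective (h : 𝒜.PreservesCoproducts) {J : Type u} {K : J → 𝒜.Obj}
    {c : Cofan K} (hc : IsColimit c) {d : Cofan fun j => 𝒜.U.obj (K j)} (hd : IsColimit d) :
    Function.Bijective (χ c hd) := by
  have := h J
  exact DBasedClass.χ_bijective c hd
    (Cofan.isColimitMapCoconeEquiv 𝒜.U K c (isColimitOfPreserves 𝒜.U hc))

/-! ### Maximal relations -/

theorem comp_le_of_lift {M N : 𝒜.Obj} {ω₁ : HU M} {ω₂ : HU N}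
    {r : L.Substructure (Alg.prod M.obj N.obj)} (hr : r ∈ piggybackRel ω₁ ω₂)
    {A : 𝒜.Obj} {x : Hom A M} {y : Hom A N} (h : lift r x y) : ω₁.comp x ≤ ω₂.comp y :=
  fun a => hr.1 _ _ (h a)

variable [L.IsAlgebraic]

/-- If `ω₁ ∘ x ≤ ω₂ ∘ y` then the subalgebra `{(x a, y a) | a ∈ A}` extends to a maximal one within
`{(a, b) | ω₁ a ≤ ω₂ b}`. -/
theorem exists_mem_piggybackRel {M N : 𝒜.Obj} [Finite M.obj] [Finite N.obj] {ω₁ : HU M}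
    {ω₂ : HU N} {A : 𝒜.Obj} {x : Hom A M} {y : Hom A N} (h : ω₁.comp x ≤ ω₂.comp y) :
    ∃ r ∈ piggybackRel ω₁ ω₂, lift r x y := by
  have _ : Finite (Alg.prod M.obj N.obj) := inferInstanceAs (Finite (M.obj × N.obj))
  have _ : Finite (L.Substructure (Alg.prod M.obj N.obj)) :=
    Finite.of_injective _ (SetLike.coe_injective (A := L.Substructure (Alg.prod M.obj N.obj)))
  obtain ⟨r, hr, hm⟩ := Finite.exists_le_maximal
    (p := fun r : L.Substructure (Alg.prod M.obj N.obj) => ∀ (a : M.obj) (b : N.obj),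
      ((a, b) : M.obj × N.obj) ∈ r → ω₁.ev a ≤ ω₂.ev b)
    (a := (Alg.pair x y).range) (by
      rintro a b ⟨c, hc⟩
      obtain rfl : x c = a := congrArg (fun p : M.obj × N.obj => p.1) hc
      obtain rfl : y c = b := congrArg (fun p : M.obj × N.obj => p.2) hc
      exact h c)
  exact ⟨r, hm, fun a => hr ⟨a, rfl⟩⟩

/-! ### Piggyback dualities -/

namespace CarrierData

variable (P : 𝒜.CarrierData)

/-- The carrier maps separate: for each `A` in the class, the maps `ω ∘ x`, for `x : A → M s` and
`ω` in `Ω s`, separate the points of `A`. Together with the class being finitely generated this amounts to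
a piggyback duality; see `Separating.isPiggybackDuality` and `IsPiggybackDuality.separating`. -/
def Separating : Prop :=
  ∀ (A : 𝒜.Obj) (a b : A.obj),
    (∀ s, ∀ ω ∈ P.Ω s, ∀ x : Hom A (P.M s), ω.ev (x a) = ω.ev (x b)) → a = b

/-- `BoundedLatticeHom.exists_apply_eq_of_monotone` for the family of all `ω ∘ x ∘ g`, indexed by the
disjoint union of one copy of `Hom A (M s)` for each carrier map in `Ω s`. The homomorphism `g` is
the identity for dualities, and `χ` for condition (S). -/
theorem exists_interpolant (A : 𝒜.Obj) {D : Type*} [DistribLattice D] [BoundedOrder D]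
    (g : BoundedLatticeHom D (𝒜.U.obj A)) (ψ : ∀ s, HU (P.M s) → Hom A (P.M s) → Bool)
    (hψ : ∀ s ω, @Continuous _ _ (homTopology A (P.M s)) _ (ψ s ω))
    (hle : ∀ s, ∀ ω ∈ P.Ω s, ∀ t, ∀ ω' ∈ P.Ω t, ∀ x y,
      (∀ d, ω.ev (x (g d)) ≤ ω'.ev (y (g d))) → ψ s ω x ≤ ψ t ω' y) :
    ∃ d, ∀ s, ∀ ω ∈ P.Ω s, ∀ x, ω.ev (x (g d)) = ψ s ω x := by
  have _ := P.finS
  have _ := P.finM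
  let _ : ∀ p : (Σ s, P.Ω s), TopologicalSpace (Hom A (P.M p.1)) :=
    fun p => homTopology A (P.M p.1)
  have _ : ∀ p : (Σ s, P.Ω s), CompactSpace (Hom A (P.M p.1)) :=
    fun p => compactSpace_hom A (P.M p.1)
  obtain ⟨d, hd⟩ := BoundedLatticeHom.exists_apply_eq_of_monotone
    (Y := Σ p : (Σ s, P.Ω s), Hom A (P.M p.1))
    (fun p => BoundedLatticeHom.comp (HU.comp p.1.2.1 p.2) g)
    (fun d => continuous_sigma fun p => continuous_ev_hom p.2.1.ev (g d))
    (fun p => ψ p.1.1 p.1.2.1 p.2) (continuous_sigma fun p => hψ p.1 p.2.1)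
    (fun p q h => hle _ _ p.1.2.2 _ _ q.1.2.2 _ _ h)
  exact ⟨d, fun s ω hω x => hd ⟨⟨s, ⟨ω, hω⟩⟩, x⟩⟩

theorem separating_of_sep (hmem : 𝒜.mem = Alg.ISP fun s => (P.M s).obj) (hsep : P.Sep) :
    P.Separating := by
  intro A a b hab
  refine (mem_iff hmem).1 A.property a b fun s x => ?_
  by_contra hne
  obtain ⟨t, y, ω, hω, h⟩ := hsep s _ _ hne
  exact h (hab t ω hω (y.comp x))

variable {P}

/-- The piggyback duality theorem: the evaluation maps are isomorphisms if the carrier maps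
separate. -/
theorem Separating.yieldsDuality (hP : P.Separating) : P.alterEgo.YieldsDuality := by
  have hfin := P.finM
  intro A
  constructor
  · intro a b hab
    exact hP A a b fun s ω _ x => congrArg ω.ev (congrFun (congrArg Subtype.val hab) ⟨s, x⟩)
  · rintro ⟨φ, hφ⟩
    obtain ⟨a, ha⟩ := P.exists_interpolant A (BoundedLatticeHom.id (𝒜.U.obj A))
      (fun s ω x => ω.ev (φ ⟨s, x⟩))
      (fun s ω => by
        let _ : TopologicalSpace (P.M s).obj := ⊥
        have _ : DiscreteTopology (P.M s).obj := ⟨rfl⟩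
        let _ := homTopology A (P.M s)
        exact (continuous_of_discreteTopology (f := ω.ev)).comp (hφ.continuous s))
      (fun s ω hω t ω' hω' x y h => by
        obtain ⟨r, hr, hl⟩ := exists_mem_piggybackRel (ω₁ := ω) (ω₂ := ω') (x := x) (y := y) h
        exact hr.1 _ _ (hφ.rel s t r ⟨ω, hω, ω', hω', hr⟩ x y hl))
    refine ⟨a, Subtype.ext (funext fun p => ?_)⟩
    obtain ⟨s, x⟩ := p
    -- So far `φ` agrees with `a` after applying carrier maps; as `φ` commutes with all homomorphisms
    -- between the sorts, separation applies on the sort itself.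
    refine hP (P.M s) _ _ fun t ω hω y => ?_
    exact (ha t ω hω (y.comp x)).trans (congrArg ω.ev (hφ.op s t y trivial x))

theorem Separating.isPiggybackDuality (h𝒜 : 𝒜.FinitelyGenerated) (hP : P.Separating) :
    P.IsPiggybackDuality := by
  refine ⟨fun s a b hab => ?_, eq_ISP_of_separating h𝒜 fun A a b h =>
    hP A a b fun s ω _ x => congrArg ω.ev (h s x), hP.yieldsDuality⟩
  by_contra! h
  exact hab (hP (P.M s) a b fun t ω hω x => h t x ω hω)

theorem IsPiggybackDuality.separating (hP : P.IsPiggybackDuality) : P.Separating :=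
  P.separating_of_sep hP.2.1 hP.1

end CarrierData

theorem isSimplePiggyback_iff (h𝒜 : 𝒜.FinitelyGenerated) {M : 𝒜.Obj} {ω : HU M} :
    IsSimplePiggyback M ω ↔ Finite M.obj ∧ Separates ω := by
  constructor
  · rintro ⟨hM, h⟩
    refine ⟨hM, fun A a b hab => h.separating A a b fun s ω' hω' x => ?_⟩
    have hω'' : ω' = ω := hω'
    rw [hω'']
    exact hab x
  · rintro ⟨hM, h⟩
    refine ⟨hM, CarrierData.Separating.isPiggybackDuality h𝒜 fun A a b hab => h A a b fun x => ?_⟩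
    exact hab () ω rfl x

/-- A separating carrier map represents the dual spaces: each element of `HU(A)` is some `ω ∘ x`. -/
theorem Separates.exists_comp_eq {M : 𝒜.Obj} [Finite M.obj] {ω : HU M} (hω : Separates ω)
    {A : 𝒜.Obj} (y : HU A) : ∃ x : Hom A M, ω.comp x = y := by
  let _ := homTopology A M
  have _ := compactSpace_hom A M
  exact BoundedLatticeHom.exists_eq_of_separating (D := 𝒜.U.obj A) (fun x : Hom A M => ω.comp x)
    (fun a => continuous_ev_hom ω.ev a) (hω A) y

/-- The generators as members of the class, with the separation property which they inherit from
`ISP`. -/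
theorem FinitelyGenerated.exists_generators (h𝒜 : 𝒜.FinitelyGenerated) :
    ∃ (S : Type) (_ : Finite S) (M : S → 𝒜.Obj), (∀ s, Finite (M s).obj) ∧
      ∀ (A : 𝒜.Obj) (a b : A.obj), (∀ s (x : Hom A (M s)), x a = x b) → a = b := by
  obtain ⟨S, hS, M, hM, h⟩ := h𝒜
  exact ⟨S, hS, fun s => ⟨M s, (mem_iff h).2 fun a b hab => hab s (FirstOrder.Language.Hom.id L _)⟩,
    hM, fun A => (mem_iff h).1 A.property⟩

theorem FinitelyGenerated.exists_isPiggybackDuality (h𝒜 : 𝒜.FinitelyGenerated) :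
    ∃ P : 𝒜.CarrierData, P.IsPiggybackDuality := by
  obtain ⟨S, hS, M, hM, h⟩ := h𝒜.exists_generators
  let P : 𝒜.CarrierData := { S := S, finS := hS, M := M, finM := hM, Ω := fun _ => Set.univ }
  have hP : P.Separating := fun A a b hab => h A a b fun s x =>
    HU.eq_of_forall_ev_eq fun ω => hab s ω trivial x
  exact ⟨P, hP.isPiggybackDuality h𝒜⟩

/-! ### Free products -/

theorem FinitelyGenerated.admitsFreeProducts (h𝒜 : 𝒜.FinitelyGenerated)
    (h : 𝒜.AdmitsSingleSortedDuality) : 𝒜.AdmitsFreeProducts := by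
  classical
  obtain ⟨T, ⟨hS⟩, hmem, -⟩ := h
  intro J K hK
  obtain ⟨c, ⟨hc⟩, -⟩ := h𝒜.exists_coproduct K
  -- Non-triviality provides homomorphisms from the other components to the generator, which are
  -- needed to extend a homomorphism from `K i` to the coproduct.
  have hhom : ∀ j, Nonempty (Hom (K j) (T.M default)) := by
    intro j
    by_contra hempty
    obtain ⟨a, b, hab⟩ := hK j
    refine hab ((mem_iff hmem).1 (K j).property a b fun s x => ?_)
    obtain rfl := hS.uniq s
    exact absurd ⟨x⟩ hempty
  have x₀ := fun j => (hhom j).some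
  refine ⟨c, ⟨hc⟩, fun i a b hab => ?_⟩
  refine (mem_iff hmem).1 (K i).property a b fun s x => ?_
  obtain rfl := hS.uniq s
  obtain ⟨z, hz⟩ := exists_hom_of_isColimit hc (Function.update x₀ i x)
  have h1 := hz i a
  have h2 := hz i b
  rw [Function.update_self] at h1 h2
  rw [← h1, ← h2, hab]

theorem FinitelyGenerated.admitsSingleSortedDuality (h𝒜 : 𝒜.FinitelyGenerated)
    (hfree : 𝒜.AdmitsFreeProducts) : 𝒜.AdmitsSingleSortedDuality := by
  obtain ⟨S, _, M, hfin, h⟩ := h𝒜.exists_generators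
  obtain ⟨c, ⟨hc⟩, hinj⟩ := hfree (ULift.{u} {s // Nontrivial (M s).obj})
    (fun j => M j.down.1) (fun j => j.down.2)
  have hcfin : Finite c.pt.obj := finite_of_isColimit h𝒜 hc fun j => hfin j.down.1
  let P : 𝒜.CarrierData :=
    { S := Unit, finS := inferInstance, M := fun _ => c.pt, finM := fun _ => hcfin
      Ω := fun _ => Set.univ }
  have hP : P.Separating := by
    intro A a b hab
    refine h A a b fun s x => ?_
    -- Trivial generators do not separate any points, so they may be left out of the coproduct.
    rcases subsingleton_or_nontrivial (M s).obj with hs | hs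
    · exact Subsingleton.elim _ _
    · refine hinj ⟨⟨s, hs⟩⟩ (HU.eq_of_forall_ev_eq fun ω => ?_)
      exact hab () ω trivial ((toHom (c.inj ⟨⟨s, hs⟩⟩)).comp x)
  exact ⟨P.alterEgo, ⟨show Unique Unit from inferInstance⟩, (hP.isPiggybackDuality h𝒜).2⟩

/-! ### Condition (E) -/

/-- A separating carrier map gives (E): a homomorphism `y` to `2` on the coproduct of the reducts has
restrictions `ω ∘ x j`, and so factors through `χ` as `ω ∘ z ∘ χ = y`. -/
theorem Separates.condE {M : 𝒜.Obj} [Finite M.obj] {ω : HU M} (hω : Separates ω) :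
    𝒜.CondE := by
  intro J K c hc d hd b b' hbb
  refine BoundedLatticeHom.eq_of_forall_apply_eq fun y => ?_
  choose x hx using fun j => hω.exists_comp_eq (A := K j) (y.comp (d.inj j).hom)
  obtain ⟨z, hz⟩ := exists_hom_of_isColimit hc x
  let y' : BoundedLatticeHom d.pt Bool := BoundedLatticeHom.comp (ω.comp z) (χ c hd).hom
  have hy : ∀ j a, y' ((d.inj j).hom a) = y ((d.inj j).hom a) := by
    intro j a
    refine (congrArg (ω.comp z).ev (χ_inj c hd j a)).trans ((congrArg ω.ev (hz j a)).trans ?_)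
    exact congrArg (fun k : HU (K j) => k.ev a) (hx j)
  have hyy : ∀ b, y' b = y b := fun b => le_antisymm
    (BddDistLat.le_of_isColimit hd y' y (fun j a => (hy j a).le) b)
    (BddDistLat.le_of_isColimit hd y y' (fun j a => (hy j a).ge) b)
  rw [← hyy, ← hyy]
  exact congrArg (ω.comp z).ev hbb

/-- Under (E), the coproduct of one copy of each generator for each element of its dual space carries
a separating map: one whose restriction to the copy indexed by `z` is `z`. -/
theorem FinitelyGenerated.exists_separates (h𝒜 : 𝒜.FinitelyGenerated) (hE : 𝒜.CondE) :
    ∃ (M : 𝒜.Obj) (ω : HU M), Finite M.obj ∧ Separates ω := by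
  obtain ⟨S, _, M, hfin, h⟩ := h𝒜.exists_generators
  let K : (Σ s, HU (M s)) → 𝒜.Obj := fun j => M j.1
  obtain ⟨c, ⟨hc⟩, -⟩ := h𝒜.exists_coproduct K
  obtain ⟨d, ⟨hd⟩⟩ := BddDistLat.exists_coproduct fun j => 𝒜.U.obj (K j)
  have hcfin : Finite c.pt.obj := finite_of_isColimit h𝒜 hc fun j => hfin j.1
  obtain ⟨y, hy⟩ := BddDistLat.exists_desc_bool hd fun j => j.2
  obtain ⟨ω, hω⟩ := BoundedLatticeHom.exists_comp_eq (χ c hd).hom (hE _ K c hc d hd) y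
  refine ⟨c.pt, ω, hcfin, fun A a b hab => ?_⟩
  refine h A a b fun s x => HU.eq_of_forall_ev_eq (A := M s) fun z => ?_
  have key : ∀ t : (M s).obj, HU.ev (A := c.pt) ω (toHom (c.inj ⟨s, z⟩) t) = z.ev t := by
    intro t
    rw [← χ_inj c hd]
    exact (congrArg (fun k => k ((d.inj ⟨s, z⟩).hom t)) hω).trans (hy ⟨s, z⟩ t)
  rw [← key, ← key]
  exact hab ((toHom (c.inj ⟨s, z⟩)).comp x)

/-! ### Condition (S) -/

/-- If each set `R_{ω₁,ω₂}` has at most one element, then all components of a non-empty coproduct are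
mapped by `(x, y)` into the same relation, and so is the coproduct. Hence the order between the maps
`ω ∘ x` on the coproduct can be checked on the range of `χ`, and (S) follows by interpolation. -/
theorem CarrierData.Separating.condS {P : 𝒜.CarrierData} (h𝒜 : 𝒜.FinitelyGenerated)
    (hP : P.Separating) (hR : P.RelLeOne) : 𝒜.CondS := by
  intro J hJ K c hc d hd a
  have hfin := P.finM
  obtain ⟨b, hb⟩ := P.exists_interpolant c.pt (χ c hd).hom (fun s ω x => ω.ev (x a))
    (fun s ω => continuous_ev_hom ω.ev a) (fun s ω hω t ω' hω' x y h => by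
      have hr : ∀ j, ∃ r ∈ piggybackRel ω ω',
          lift r (x.comp (toHom (c.inj j))) (y.comp (toHom (c.inj j))) := fun j =>
        exists_mem_piggybackRel fun k => by
          have := h ((d.inj j).hom k)
          rwa [χ_inj] at this
      obtain ⟨r, hr₀, -⟩ := hr hJ.some
      refine hr₀.1 _ _ (mem_of_isColimit h𝒜 hc (r.comap (Alg.pair x y)) (fun j k => ?_) a)
      obtain ⟨r', hr', hl⟩ := hr j
      obtain rfl := Set.encard_le_one_iff.1 (hR s t ω hω ω' hω') r' r hr' hr₀
      exact hl k)
  exact ⟨b, hP c.pt _ _ hb⟩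

/-- Under (S), two relations `r₁`, `r₂` in `R_{ω₁,ω₂}` are equal: the projections `x`, `y` of their
coproduct satisfy `ω₁ ∘ x ≤ ω₂ ∘ y`, so the relation `{(x a, y a)}`, which contains `r₁` and `r₂`, is
contained in `{(a, b) | ω₁ a ≤ ω₂ b}`. -/
theorem CondS.encard_piggybackRel_le_one (h𝒜 : 𝒜.FinitelyGenerated) (hS : 𝒜.CondS) {M N : 𝒜.Obj}
    (ω₁ : HU M) (ω₂ : HU N) : (piggybackRel ω₁ ω₂).encard ≤ 1 := by
  refine Set.encard_le_one_iff.2 fun r₁ r₂ h₁ h₂ => ?_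
  let r : Bool → L.Substructure (Alg.prod M.obj N.obj) := fun b => bif b then r₁ else r₂
  have hr : ∀ b, r b ∈ piggybackRel ω₁ ω₂ := fun b => by cases b <;> assumption
  let K : ULift.{u} Bool → 𝒜.Obj := fun j => h𝒜.sub (h𝒜.prod M N) (r j.down)
  obtain ⟨c, ⟨hc⟩, -⟩ := h𝒜.exists_coproduct K
  obtain ⟨d, ⟨hd⟩⟩ := BddDistLat.exists_coproduct fun j => 𝒜.U.obj (K j)
  obtain ⟨x, hx⟩ := exists_hom_of_isColimit hc (A := M) fun j =>
    (Alg.fst M.obj N.obj).comp (r j.down).subtype.toHom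
  obtain ⟨y, hy⟩ := exists_hom_of_isColimit hc (A := N) fun j =>
    (Alg.snd M.obj N.obj).comp (r j.down).subtype.toHom
  have hle : ω₁.comp x ≤ ω₂.comp y := by
    intro a
    obtain ⟨b, rfl⟩ := hS _ K c hc d hd a
    refine BddDistLat.le_of_isColimit hd
      (BoundedLatticeHom.comp (ω₁.comp x) (χ c hd).hom)
      (BoundedLatticeHom.comp (ω₂.comp y) (χ c hd).hom) (fun j k => ?_) b
    have hk := χ_inj c hd j k
    let k' : r j.down := k
    have h₁ : (ω₁.comp x).ev ((χ c hd).hom ((d.inj j).hom k)) = ω₁.ev k'.1.1 :=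
      (congrArg (ω₁.comp x).ev hk).trans (congrArg ω₁.ev (hx j k))
    have h₂ : (ω₂.comp y).ev ((χ c hd).hom ((d.inj j).hom k)) = ω₂.ev k'.1.2 :=
      (congrArg (ω₂.comp y).ev hk).trans (congrArg ω₂.ev (hy j k))
    exact (h₁.trans_le ((hr j.down).1 _ _ k'.2)).trans h₂.ge
  let t : L.Substructure (Alg.prod M.obj N.obj) := (Alg.pair x y).range
  have ht : ∀ (a : M.obj) (b : N.obj), ((a, b) : M.obj × N.obj) ∈ t → ω₁.ev a ≤ ω₂.ev b := by
    rintro a b ⟨k, hk⟩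
    obtain rfl : x k = a := congrArg (fun p : M.obj × N.obj => p.1) hk
    obtain rfl : y k = b := congrArg (fun p : M.obj × N.obj => p.2) hk
    exact hle k
  have hle' : ∀ b, r b ≤ t := fun b p hp =>
    ⟨toHom (c.inj ⟨b⟩) ⟨p, hp⟩, Prod.ext (hx ⟨b⟩ ⟨p, hp⟩) (hy ⟨b⟩ ⟨p, hp⟩)⟩
  have hrt : ∀ b, r b = t := fun b => le_antisymm (hle' b) ((hr b).2 ht (hle' b))
  exact (hrt true).trans (hrt false).symm

/-! ### Preservation of coproducts -/

theorem Separates.preservesCoproducts {M : 𝒜.Obj} [Finite M.obj] {ω : HU M}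
    (h𝒜 : 𝒜.FinitelyGenerated) (hω : Separates ω) (hS : 𝒜.CondS) : 𝒜.PreservesCoproducts := by
  intro J
  have (K : J → 𝒜.Obj) : PreservesColimit (Discrete.functor K) 𝒜.U := by
    obtain ⟨c, ⟨hc⟩, -⟩ := h𝒜.exists_coproduct K
    obtain ⟨d, ⟨hd⟩⟩ := BddDistLat.exists_coproduct fun j => 𝒜.U.obj (K j)
    refine preservesColimit_of_preserves_colimit_cocone hc
      ((Cofan.isColimitMapCoconeEquiv 𝒜.U K c).symm
        (nonempty_isColimit_of_χ_bijective c hd ⟨hω.condE J K c hc d hd, ?_⟩).some)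
    rcases isEmpty_or_nonempty J with hJ | hJ
    · exact hω.surjective_χ_of_isEmpty hc hd
    · exact hS J K c hc d hd
  exact preservesColimitsOfShape_of_discrete _

/-- The representation of homomorphisms by structure-preserving maps of dual spaces. Priestley duality
gives a map `f` dual to `φ`; preservation of the relation means that each `z ∘ f`, for `z : B → M`, is
a homomorphism, whence so is `f`. -/
theorem Separates.existsUnique_hom {M : 𝒜.Obj} {ω : HU M} (hω : Separates ω) {A B : 𝒜.Obj}
    {φ : HU B → HU A} (hφ : Continuous φ) (hmono : Monotone φ)
    (hrel : ∀ τ ∈ inducedRel ω B, (fun u => φ (τ u)) ∈ inducedRel ω A) :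
    ∃! f : Hom A B, ∀ y : HU B, φ y = y.comp f := by
  have hex : ∀ a : A.obj, ∃ b : B.obj, ∀ y : HU B, y.ev b = (φ y).ev a := fun a =>
    BoundedLatticeHom.exists_apply_eq_of_monotone (D := 𝒜.U.obj B) (Y := HU B) (fun y => y)
      HU.continuous_ev (fun y => (φ y).ev a) ((HU.continuous_ev a).comp hφ)
      fun y z h => hmono h a
  choose f hf using hex
  have hhom : ∀ z : Hom B M, ∃ x : Hom A M, ∀ a, x a = z (f a) := by
    intro z
    obtain ⟨x, hx⟩ := hrel (fun u => ω.comp (u.comp z)) ⟨z, fun u => rfl⟩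
    refine ⟨x, fun a => hω M _ _ fun u => ?_⟩
    exact (congrArg (fun y => y.ev a) (hx u)).symm.trans (hf a _).symm
  refine ⟨Alg.homMk f fun {n} g t => ?_, fun y => HU.ext fun a => (hf a y).symm,
    fun f' hf' => FirstOrder.Language.Hom.ext fun a => ?_⟩
  · refine hω B _ _ fun z => congrArg ω.ev ?_
    obtain ⟨x, hx⟩ := hhom z
    rw [← hx, x.map_fun, z.map_fun]
    exact congrArg (Structure.funMap g) (funext fun i => hx (t i))
  · refine HU.eq_of_forall_ev_eq fun y => ?_
    exact (congrArg (fun z => z.ev a) (hf' y)).symm.trans (hf a y).symm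

theorem Separates.isDPBased {M : 𝒜.Obj} [Finite M.obj] {ω : HU M}
    (h𝒜 : 𝒜.FinitelyGenerated) (hω : Separates ω) (hS : 𝒜.CondS) : IsDPBased ω where
  rel := by
    have hone := Set.encard_le_one_iff.1 (hS.encard_piggybackRel_le_one h𝒜 ω ω)
    obtain ⟨r, hr, -⟩ := exists_mem_piggybackRel
      (le_refl (ω.comp (FirstOrder.Language.Hom.id L M.obj)))
    refine ⟨r, Set.eq_singleton_iff_unique_mem.2 ⟨hr, fun s hs => hone s r hs hr⟩,
      fun A x y => ⟨comp_le_of_lift hr, fun h => ?_⟩⟩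
    obtain ⟨s, hs, hl⟩ := exists_mem_piggybackRel h
    exact hone s r hs hr ▸ hl
  quotient A := by
    let _ := homTopology A M
    have _ := compactSpace_hom A M
    exact Topology.IsQuotientMap.of_surjective_continuous (fun y => hω.exists_comp_eq y)
      (continuous_induced_rng.2 (continuous_pi fun a => continuous_ev_hom ω.ev a))
  morphisms A B φ := by
    refine ⟨fun h => hω.existsUnique_hom h.1 h.2.1 h.2.2, ?_⟩
    rintro ⟨f, hf, -⟩
    refine ⟨continuous_induced_rng.2 (continuous_pi fun a => ?_), fun y z h a => ?_, ?_⟩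
    · exact (HU.continuous_ev (f a)).congr fun y => by
        simp only [Function.comp_apply, hf]; rfl
    · rw [hf, hf]
      exact h (f a)
    · rintro τ ⟨x, hx⟩
      refine ⟨x.comp f, fun u => ?_⟩
      simp only [hf, hx]
      rfl

/-- As `R_{ω,ω}` is a singleton, `CarrierData.Separating.condS` applies. -/
theorem IsDPBased.condS {M : 𝒜.Obj} [hM : Finite M.obj] {ω : HU M} (h𝒜 : 𝒜.FinitelyGenerated)
    (hω : Separates ω) (h : IsDPBased ω) : 𝒜.CondS := by
  obtain ⟨r, hr, -⟩ := h.rel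
  refine CarrierData.Separating.condS (P := CarrierData.simple M hM ω) h𝒜
    (fun A a b hab => hω A a b (hab () ω rfl)) fun s t ω₁ h₁ ω₂ h₂ => ?_
  have h₁' : ω₁ = ω := h₁
  have h₂' : ω₂ = ω := h₂
  change (piggybackRel (M := M) (N := M) ω₁ ω₂).encard ≤ 1
  rw [h₁', h₂', hr, Set.encard_singleton]

/-! ### Varieties -/

/-- A variety is closed under quotients by congruences. -/
theorem ClosedUnderImages.exists_quotient (hv : 𝒜.ClosedUnderImages) (M : 𝒜.Obj)
    (θ : L.Substructure (Alg.prod M.obj M.obj))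
    (hθ : Equivalence fun a b : M.obj => ((a, b) : M.obj × M.obj) ∈ θ) :
    ∃ (N : 𝒜.Obj) (q : Hom M N), Function.Surjective q ∧
      ∀ a b, q a = q b ↔ ((a, b) : M.obj × M.obj) ∈ θ := by
  let s : Setoid M.obj := ⟨_, hθ⟩
  let Q : Alg.{v, w, u} L := Alg.quotient M.obj s
  let q : M.obj →[L] Alg.quotient M.obj s :=
    Alg.homMk (fun a => (⟦a⟧ : Quotient s)) fun f x => Quotient.sound
    (θ.fun_mem f (fun i => ((x i, (⟦x i⟧ : Quotient s).out) : M.obj × M.obj))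
      fun i => hθ.symm (Quotient.mk_out (s := s) (x i)))
  have hq : Function.Surjective q := Quotient.mk_surjective
  exact ⟨⟨Q, hv M.obj Q q hq M.property⟩, q, hq, fun a b => Quotient.eq (r := s)⟩

/-- In a variety the carrier algebra can be chosen so that all maps `x ↦ ω ∘ x` are injective: divide
`M` by the congruence `r ∩ r⁻¹`, where `r` is the relation in `R_{ω,ω}`. -/
theorem ClosedUnderImages.exists_separates_injective (h𝒜 : 𝒜.FinitelyGenerated)
    (hv : 𝒜.ClosedUnderImages) {M : 𝒜.Obj} [Finite M.obj] {ω : HU M} (hω : Separates ω)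
    (h : IsDPBased ω) :
    ∃ (N : 𝒜.Obj) (ω' : HU N), Finite N.obj ∧ Separates ω' ∧
      ∀ A : 𝒜.Obj, Function.Injective fun x : Hom A N => ω'.comp x := by
  obtain ⟨r, -, hr⟩ := h.rel
  let swap : Alg.prod M.obj M.obj →[L] Alg.prod M.obj M.obj :=
    Alg.pair (Alg.snd M.obj M.obj) (Alg.fst M.obj M.obj)
  let θ : L.Substructure (Alg.prod M.obj M.obj) := r ⊓ r.comap swap
  have hθ : ∀ {a b : M.obj}, ((a, b) : M.obj × M.obj) ∈ θ ↔
      ((a, b) : M.obj × M.obj) ∈ r ∧ ((b, a) : M.obj × M.obj) ∈ r := Iff.rfl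
  have hrefl : ∀ a : M.obj, ((a, a) : M.obj × M.obj) ∈ r := fun a =>
    (hr M (FirstOrder.Language.Hom.id L _) (FirstOrder.Language.Hom.id L _)).2 le_rfl a
  -- Transitivity holds because the lifting of `r` is the pullback of an order; it is applied to the
  -- algebra of all triples `(a, b, c)` with `(a, b)` and `(b, c)` in `r`.
  have htrans : ∀ {a b c : M.obj}, ((a, b) : M.obj × M.obj) ∈ r → ((b, c) : M.obj × M.obj) ∈ r →
      ((a, c) : M.obj × M.obj) ∈ r := by
    intro a b c hab hbc
    let C : Alg.{v, w, u} L := Alg.prod M.obj (Alg.prod M.obj M.obj)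
    let x₁ : C →[L] M.obj := Alg.fst _ _
    let x₂ : C →[L] M.obj := (Alg.fst _ _).comp (Alg.snd _ _)
    let x₃ : C →[L] M.obj := (Alg.snd _ _).comp (Alg.snd _ _)
    let T : L.Substructure C := r.comap (Alg.pair x₁ x₂) ⊓ r.comap (Alg.pair x₂ x₃)
    let A : 𝒜.Obj := h𝒜.sub (h𝒜.prod M (h𝒜.prod M M)) T
    let i : A.obj →[L] C := T.subtype.toHom
    have h₁₂ : ω.comp (x₁.comp i : Hom A M) ≤ ω.comp (x₂.comp i : Hom A M) :=
      (hr A _ _).1 fun t => t.2.1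
    have h₂₃ : ω.comp (x₂.comp i : Hom A M) ≤ ω.comp (x₃.comp i : Hom A M) :=
      (hr A _ _).1 fun t => t.2.2
    exact (hr A _ _).2 (h₁₂.trans h₂₃)
      (⟨((a, b, c) : M.obj × M.obj × M.obj), hab, hbc⟩ : T)
  obtain ⟨N, q, hq, hqθ⟩ := hv.exists_quotient M θ
    ⟨fun a => ⟨hrefl a, hrefl a⟩, fun h => ⟨h.2, h.1⟩,
      fun h h' => ⟨htrans h.1 h'.1, htrans h'.2 h.2⟩⟩
  have hle : ∀ {a b : M.obj}, ((a, b) : M.obj × M.obj) ∈ r → ω.ev a ≤ ω.ev b := by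
    intro a b hab
    let A : 𝒜.Obj := h𝒜.sub (h𝒜.prod M M) r
    let i : A.obj →[L] Alg.prod M.obj M.obj := r.subtype.toHom
    exact (hr A ((Alg.fst _ _).comp i) ((Alg.snd _ _).comp i)).1 (fun t => t.2)
      (⟨((a, b) : M.obj × M.obj), hab⟩ : r)
  obtain ⟨ω', hω'⟩ := exists_comp_eq_of_surjective q hq ω fun a b hab =>
    le_antisymm (hle ((hqθ a b).1 hab).1) (hle ((hqθ a b).1 hab).2)
  have hev : ∀ a, ω'.ev (q a) = ω.ev a := fun a => congrArg (fun y => y.ev a) hω'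
  refine ⟨N, ω', Finite.of_surjective q hq, fun A a b hab => hω A a b fun x => ?_,
    fun A x x' hxx => ?_⟩
  · rw [← hev, ← hev]
    exact hab (q.comp x)
  · refine FirstOrder.Language.Hom.ext fun c => ?_
    obtain ⟨a, ha⟩ := hq (x c)
    obtain ⟨b, hb⟩ := hq (x' c)
    -- The homomorphisms `x` and `x'` need not lift along `q`. They do on the algebra of all `(c, a, b)`
    -- with `q a = x c` and `q b = x' c`.
    let C : Alg.{v, w, u} L := Alg.prod A.obj (Alg.prod M.obj M.obj)
    let p : C →[L] A.obj := Alg.fst _ _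
    let y : C →[L] M.obj := (Alg.fst _ _).comp (Alg.snd _ _)
    let y' : C →[L] M.obj := (Alg.snd _ _).comp (Alg.snd _ _)
    let T : L.Substructure C := (q.comp y).eqLocus (x.comp p) ⊓ (q.comp y').eqLocus (x'.comp p)
    let B : 𝒜.Obj := h𝒜.sub (h𝒜.prod A (h𝒜.prod M M)) T
    let i : B.obj →[L] C := T.subtype.toHom
    have heq : ω.comp (y.comp i : Hom B M) = ω.comp (y'.comp i : Hom B M) := by
      refine HU.ext fun t => ?_
      have h1 : q (y (i t)) = x (p (i t)) := t.2.1
      have h2 : q (y' (i t)) = x' (p (i t)) := t.2.2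
      change ω.ev (y (i t)) = ω.ev (y' (i t))
      rw [← hev, ← hev, h1, h2]
      exact congrArg (fun z : HU A => z.ev (p (i t))) hxx
    let t : T := ⟨((c, a, b) : A.obj × M.obj × M.obj), ha, hb⟩
    rw [← ha, ← hb, hqθ]
    exact ⟨(hr B _ _).2 heq.le t, (hr B _ _).2 heq.ge t⟩

end DBasedClass

theorem theorem3p8 {L : FirstOrder.Language.{v, w}} [L.IsAlgebraic] (𝒜 : DBasedClass.{v, w, u} L)
    (h𝒜 : 𝒜.FinitelyGenerated) :
    (𝒜.AdmitsFreeProducts ↔ 𝒜.AdmitsSingleSortedDuality) ∧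
    (𝒜.CondE ↔ ∃ (M : 𝒜.Obj) (ω : DBasedClass.HU M), DBasedClass.IsSimplePiggyback M ω) ∧
    ((𝒜.CondS ↔ ∃ P : 𝒜.CarrierData, P.IsPiggybackDuality ∧ P.RelLeOne) ∧
      ((∃ P : 𝒜.CarrierData, P.IsPiggybackDuality ∧ P.RelLeOne) →
        ∀ P : 𝒜.CarrierData, P.IsPiggybackDuality → P.RelLeOne)) ∧
    ((𝒜.PreservesCoproducts ↔ ∃ (M : 𝒜.Obj) (ω : DBasedClass.HU M),
        DBasedClass.IsSimplePiggyback M ω ∧ DBasedClass.IsDPBased ω) ∧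
      (𝒜.ClosedUnderImages →
        (𝒜.PreservesCoproducts ↔ ∃ (M : 𝒜.Obj) (ω : DBasedClass.HU M),
          DBasedClass.IsSimplePiggyback M ω ∧ DBasedClass.IsDPBased ω ∧
          ∀ A : 𝒜.Obj, Function.Injective fun x : DBasedClass.Hom A M => ω.comp x))) := by
  have hE : 𝒜.CondE ↔ ∃ (M : 𝒜.Obj) (ω : DBasedClass.HU M),
      DBasedClass.IsSimplePiggyback M ω := by
    simp only [DBasedClass.isSimplePiggyback_iff h𝒜]
    exact ⟨h𝒜.exists_separates, fun ⟨M, ω, hM, hω⟩ => hω.condE⟩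
  have hS : ∀ P : 𝒜.CarrierData, P.IsPiggybackDuality → P.RelLeOne → 𝒜.CondS :=
    fun P hP hR => hP.separating.condS h𝒜 hR
  have hR : 𝒜.CondS → ∀ P : 𝒜.CarrierData, P.RelLeOne := fun hS P s t ω₁ _ ω₂ _ =>
    hS.encard_piggybackRel_le_one h𝒜 ω₁ ω₂
  have hU : 𝒜.PreservesCoproducts → 𝒜.CondE ∧ 𝒜.CondS := fun h =>
    ⟨fun _ _ _ hc _ hd => (h.χ_bijective hc hd).1, fun _ _ _ _ hc _ hd => (h.χ_bijective hc hd).2⟩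
  have hU' : ∀ (M : 𝒜.Obj) (ω : DBasedClass.HU M), DBasedClass.IsSimplePiggyback M ω →
      DBasedClass.IsDPBased ω → 𝒜.PreservesCoproducts := by
    intro M ω h hDP
    obtain ⟨hM, hω⟩ := (DBasedClass.isSimplePiggyback_iff h𝒜).1 h
    exact hω.preservesCoproducts h𝒜 (hDP.condS h𝒜 hω)
  refine ⟨⟨h𝒜.admitsSingleSortedDuality, h𝒜.admitsFreeProducts⟩, hE, ⟨⟨fun h => ?_, ?_⟩, ?_⟩,
    ⟨fun h => ?_, fun ⟨M, ω, h, hDP⟩ => hU' M ω h hDP⟩,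
    fun hv => ⟨fun h => ?_, fun ⟨M, ω, h, hDP, _⟩ => hU' M ω h hDP⟩⟩
  · obtain ⟨P, hP⟩ := h𝒜.exists_isPiggybackDuality
    exact ⟨P, hP, hR h P⟩
  · rintro ⟨P, hP, hP'⟩
    exact hS P hP hP'
  · rintro ⟨P, hP, hP'⟩ Q -
    exact hR (hS P hP hP') Q
  · obtain ⟨M, ω, hM, hω⟩ := h𝒜.exists_separates (hU h).1
    exact ⟨M, ω, (DBasedClass.isSimplePiggyback_iff h𝒜).2 ⟨hM, hω⟩, hω.isDPBased h𝒜 (hU h).2⟩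
  · obtain ⟨M, ω, hM, hω⟩ := h𝒜.exists_separates (hU h).1
    obtain ⟨N, ω', hN, hω', hinj⟩ := hv.exists_separates_injective h𝒜 hω
      (hω.isDPBased h𝒜 (hU h).2)
    exact ⟨N, ω', (DBasedClass.isSimplePiggyback_iff h𝒜).2 ⟨hN, hω'⟩,
      hω'.isDPBased h𝒜 (hU h).2, hinj⟩
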